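/- Let $d\ge 2$ and let $K\subseteq\mathbf R^d$ be a closed convex set whose affine hull has dimension $\dim(K)\in\{1,\dots,d-1\}$. Put $\Omega=\mathbf R^d\setminus K$, let $d_H$ be the Hausdorff dimension of the boundary $\Gamma=\partial\Omega$, and let $d_\Gamma(x)=\inf_{y\in\Omega^c}|x-y|$ be the Euclidean distance from $x\in\Omega$ to $\Gamma$. Let $\delta,\delta'\ge 0$, $c(s)=s^{\delta}(1+s)^{\delta'-\delta}$ for $s>0$, and $c_\Omega=c\circ d_\Gamma$. Let $p\in[1,\infty)$ and suppose that $d-d_H+\min(\delta,\delta')-p>0$. Let \[ \mu_p(\Omega)=\inf\left\{\frac{\int_\Omega c_\Omega\,|\nabla\varphi|^p}{\int_\Omega c_\Omega\,d_\Gamma^{-p}\,|\varphi|^p}\;:\;\varphi\in C_c^1(\Omega),\ \varphi\neq 0\right\} \] be the optimal constant in the weighted Hardy inequality $\int_\Omega c_\Omega|\nabla\varphi|^p\ge\mu\int_\Omega c_\Omega\,d_\Gamma^{-p}|\varphi|^p$ for real-valued $\varphi\in C_c^1(\Omega)$. Then \[ \mu_p(\Omega)\le\left(\frac{d-d_H+\delta-p}{p}\right)^p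 . \] Moreover, if $\delta\le\delta'$, then \[ \mu_p(\Omega)=\left(\frac{d-d_H+\delta-p}{p}\right)^p . \] -/

import Mathlib

open MeasureTheory

noncomputable section

/-- Euclidean distance from `x` to the boundary of `Ω`, in the form `inf {|x - y| : y ∉ Ω}`
(for `x ∈ Ω` this is the distance to `∂Ω`). -/
def boundaryDist {d : ℕ} (Ω : Set (EuclideanSpace ℝ (Fin d))) (x : EuclideanSpace ℝ (Fin d)) : ℝ :=
  Metric.infDist x Ωᶜ

/-- The weight `c(s) = s ^ δ (1 + s) ^ (δ' - δ)` for `s > 0`; it behaves like `s ^ δ` as `s → 0`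
and like `s ^ δ'` as `s → ∞`. -/
def hardyWeight (δ δ' s : ℝ) : ℝ :=
  s ^ δ * (1 + s) ^ (δ' - δ)

/-- `φ ∈ C_c^1(Ω)`, real-valued: `φ` (extended by zero) is `C^1` and its support is a compact
subset of `Ω`. -/
structure IsTestFunction {d : ℕ} (Ω : Set (EuclideanSpace ℝ (Fin d)))
    (φ : EuclideanSpace ℝ (Fin d) → ℝ) : Prop where
  contDiff : ContDiff ℝ 1 φ
  hasCompactSupport : HasCompactSupport φ
  tsupport_subset : tsupport φ ⊆ Ω

/-- `∫_Ω c(d_Γ) |∇φ|^p`. -/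
def hardyEnergy {d : ℕ} (Ω : Set (EuclideanSpace ℝ (Fin d))) (δ δ' p : ℝ)
    (φ : EuclideanSpace ℝ (Fin d) → ℝ) : ℝ :=
  ∫ x in Ω, hardyWeight δ δ' (boundaryDist Ω x) * ‖gradient φ x‖ ^ p

/-- `∫_Ω c(d_Γ) d_Γ^{-p} |φ|^p`. -/
def hardyPotential {d : ℕ} (Ω : Set (EuclideanSpace ℝ (Fin d))) (δ δ' p : ℝ)
    (φ : EuclideanSpace ℝ (Fin d) → ℝ) : ℝ :=
  ∫ x in Ω, hardyWeight δ δ' (boundaryDist Ω x) * boundaryDist Ω x ^ (-p) * |φ x| ^ p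

/-- The optimal Hardy constant `μ_p(Ω)`: the infimum of the quotients
`∫_Ω c(d_Γ) |∇φ|^p / ∫_Ω c(d_Γ) d_Γ^{-p} |φ|^p` over the nonzero `φ ∈ C_c^1(Ω)`. Both integrands
are continuous with compact support in `Ω`, and the denominator is positive when `φ ≠ 0`. -/
def hardyConstant {d : ℕ} (Ω : Set (EuclideanSpace ℝ (Fin d))) (δ δ' p : ℝ) : ℝ :=
  sInf {r : ℝ | ∃ φ : EuclideanSpace ℝ (Fin d) → ℝ, IsTestFunction Ω φ ∧ φ ≠ 0 ∧
    r = hardyEnergy Ω δ δ' p φ / hardyPotential Ω δ δ' p φ}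

/-- The dimension of a convex set: the dimension of its affine hull. -/
def convexDim {d : ℕ} (K : Set (EuclideanSpace ℝ (Fin d))) : ℕ :=
  Module.finrank ℝ (affineSpan ℝ K).direction

/-- The Hausdorff dimension `d_H` of the boundary of `Ω` (always finite in `ℝ^d`). -/
def boundaryDim {d : ℕ} (Ω : Set (EuclideanSpace ℝ (Fin d))) : ℝ :=
  (dimH (frontier Ω)).toReal

end

/-! Since `dim K < d`, `K` has empty interior, so `Γ = K` and `d - d_H` is the codimension `n` of
the affine hull. Put `V = vectorSpan ℝ K`, `a = (n + δ - p) / p > 0` and `r = d_Γ`; the claimed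
constant is `a ^ p`.

Lower bound, `δ ≤ δ'` (`lintegral_hardy_le`). Let `P` be the nearest-point map and `F_s x = P x + s
(x - P x)`. Integrating `∇φ` along the normal ray gives `|φ x| ≤ r ∫_1^∞ |∇φ (F_s x)| ds`. Hölder
against the density `a s^(-1-a)`, the bound `c(r) ≤ s^(-δ) c(s r)` and Tonelli leave the integral
over `x` of a function of `F_s x`. By `IsNearestPointMap.lintegral_ray_le` the dilation `F_s`
expands volume by at least `s^n`. The powers of `s` then combine to `s^(-1-a)`, whose integral is `1
/ a`, and the constant is exactly `a^(-p)`.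

Upper bound, any `δ, δ'` (`exists_lintegral_hardy_le`). Near a relatively interior point, `r` is the
distance to the affine hull. There `r^(-a)` is cut off smoothly along `V` and, across `V`, on the
scale `log r / N`. The gradient is at most `a φ / r` plus an error `O(r^(-a-1) / N)`. The main term
contributes exactly `a^p` times the potential. The `p`-th power of the error is controlled by an
integral of `r^(-n)`, which is invariant under scaling across `V` and hence comparable to its part
on the middle third of the logarithmic range, where the potential dominates it. By Minkowski the
error vanishes as `N → ∞`, so crude two-sided bounds on the weight suffice. -/

section HardyConvexComplement

open Metric Set Module Submodule
open scoped RealInnerProductSpace ENNReal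

/-! ### Nearest-point projection onto a convex set. -/

section NearestPoint

variable {E : Type*} [NormedAddCommGroup E] [InnerProductSpace ℝ E]

/-- `P` sends each point to a point of `K` satisfying the variational inequality that
characterizes the nearest point of a convex set. -/
structure IsNearestPointMap (K : Set E) (P : E → E) : Prop where
  mem : ∀ x, P x ∈ K
  inner_le : ∀ x, ∀ y ∈ K, ⟪x - P x, y - P x⟫ ≤ 0

theorem Convex.exists_isNearestPointMap [CompleteSpace E] {K : Set E} (hc : IsClosed K)
    (hK : Convex ℝ K) (hne : K.Nonempty) : ∃ P : E → E, IsNearestPointMap K P := by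
  choose P hP hP' using exists_norm_eq_iInf_of_complete_convex hne hc.isComplete hK
  exact ⟨P, hP, fun x => (norm_eq_iInf_iff_real_inner_le_zero hK (hP x)).1 (hP' x)⟩

namespace IsNearestPointMap

variable {K : Set E} {P : E → E} (hP : IsNearestPointMap K P)
include hP

/-- Firm nonexpansiveness: add the variational inequalities at `x` and `y`, each tested at the
other's nearest point. -/
theorem sq_norm_sub_le (x y : E) : ‖P x - P y‖ ^ 2 ≤ ⟪x - y, P x - P y⟫ := by
  have h1 := hP.inner_le x (P y) (hP.mem y)
  have h2 := hP.inner_le y (P x) (hP.mem x)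
  have h3 : ‖P x - P y‖ ^ 2 = ⟪x - y, P x - P y⟫ + ⟪x - P x, P y - P x⟫ + ⟪y - P y, P x - P y⟫ := by
    rw [← real_inner_self_eq_norm_sq]
    simp only [inner_sub_left, inner_sub_right]
    ring
  linarith

theorem eq_of_inner_le {x z : E} (hz : z ∈ K) (h : ∀ y ∈ K, ⟪x - z, y - z⟫ ≤ 0) : P x = z := by
  have h1 := hP.inner_le x z hz
  have h2 := h (P x) (hP.mem x)
  have h3 : ‖P x - z‖ ^ 2 = ⟪x - P x, z - P x⟫ + ⟪x - z, P x - z⟫ := by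
    rw [← real_inner_self_eq_norm_sq]
    simp only [inner_sub_left, inner_sub_right]
    ring
  have h4 : ‖P x - z‖ ^ 2 ≤ 0 := by linarith
  have h5 : ‖P x - z‖ = 0 := by nlinarith [norm_nonneg (P x - z)]
  exact sub_eq_zero.1 (norm_eq_zero.1 h5)

theorem infDist_eq (x : E) : infDist x K = ‖x - P x‖ := by
  refine le_antisymm ?_ ((le_infDist ⟨_, hP.mem x⟩).2 fun y hy => ?_)
  · rw [← dist_eq_norm]
    exact infDist_le_dist_of_mem (hP.mem x)
  · rw [dist_eq_norm]
    have h1 := hP.inner_le x y hy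
    have h2 : ‖x - y‖ ^ 2 = ‖x - P x‖ ^ 2 + ‖y - P x‖ ^ 2 - 2 * ⟪x - P x, y - P x⟫ := by
      rw [show x - y = (x - P x) - (y - P x) by abel, norm_sub_sq_real]
      ring
    refine le_of_sq_le_sq ?_ (norm_nonneg _)
    nlinarith [sq_nonneg ‖y - P x‖]

theorem lipschitzWith : LipschitzWith 1 P := by
  refine LipschitzWith.of_dist_le_mul fun x y => ?_
  rw [dist_eq_norm, dist_eq_norm, NNReal.coe_one, one_mul]
  have h := (hP.sq_norm_sub_le x y).trans (real_inner_le_norm _ _)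
  rcases (norm_nonneg (P x - P y)).eq_or_lt with h0 | h0
  · rw [← h0]
    exact norm_nonneg _
  · nlinarith

theorem continuous : Continuous P := hP.lipschitzWith.continuous

/-- The variational inequality is preserved when `x - P x` is multiplied by a nonnegative scalar. -/
theorem apply_ray (x : E) {s : ℝ} (hs : 0 ≤ s) : P (P x + s • (x - P x)) = P x := by
  refine hP.eq_of_inner_le (hP.mem x) fun y hy => ?_
  rw [add_sub_cancel_left, real_inner_smul_left]
  exact mul_nonpos_of_nonneg_of_nonpos hs (hP.inner_le x y hy)

theorem infDist_ray (x : E) {s : ℝ} (hs : 0 ≤ s) :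
    infDist (P x + s • (x - P x)) K = s * infDist x K := by
  rw [hP.infDist_eq, hP.infDist_eq, hP.apply_ray x hs, add_sub_cancel_left, norm_smul,
    Real.norm_of_nonneg hs]

theorem sub_mem_vectorSpan (x y : E) : P x - P y ∈ vectorSpan ℝ K :=
  vsub_mem_vectorSpan ℝ (hP.mem x) (hP.mem y)

/-- Values of `P` differ by vectors of `vectorSpan ℝ K`, so the right side of `sq_norm_sub_le`
vanishes. -/
theorem apply_eq_of_sub_mem_orthogonal {x y : E} (h : x - y ∈ (vectorSpan ℝ K)ᗮ) : P x = P y := by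
  have h1 := hP.sq_norm_sub_le x y
  rw [real_inner_comm, (vectorSpan ℝ K).mem_orthogonal _ |>.1 h _ (hP.sub_mem_vectorSpan x y)] at h1
  have h5 : ‖P x - P y‖ = 0 := by nlinarith [norm_nonneg (P x - P y)]
  exact sub_eq_zero.1 (norm_eq_zero.1 h5)

end IsNearestPointMap

end NearestPoint

/-! ### Anisotropic scalings and volume. -/

section OrthogonalScaling

variable {E : Type*} [NormedAddCommGroup E] [InnerProductSpace ℝ E] [FiniteDimensional ℝ E]

/-- The linear map that multiplies vectors of `V` by `α` and vectors of `Vᗮ` by `β`. -/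
noncomputable def orthogonalScaling (V : Submodule ℝ E) (α β : ℝ) : E →ₗ[ℝ] E :=
  α • (V.starProjection : E →ₗ[ℝ] E) + β • (Vᗮ.starProjection : E →ₗ[ℝ] E)

theorem orthogonalScaling_apply (V : Submodule ℝ E) (α β : ℝ) (x : E) :
    orthogonalScaling V α β x = α • V.starProjection x + β • Vᗮ.starProjection x := rfl

theorem starProjection_orthogonalScaling (V : Submodule ℝ E) (α β : ℝ) (x : E) :
    V.starProjection (orthogonalScaling V α β x) = α • V.starProjection x := by
  have h1 : V.starProjection (V.starProjection x) = V.starProjection x :=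
    starProjection_eq_self_iff.2 (starProjection_apply_mem _ _)
  have h2 : V.starProjection (Vᗮ.starProjection x) = 0 :=
    (starProjection_apply_eq_zero_iff _).2 (starProjection_apply_mem _ _)
  rw [orthogonalScaling_apply, map_add, map_smul, map_smul, h1, h2, smul_zero, add_zero]

theorem orthogonal_starProjection_orthogonalScaling (V : Submodule ℝ E) (α β : ℝ) (x : E) :
    Vᗮ.starProjection (orthogonalScaling V α β x) = β • Vᗮ.starProjection x := by
  have h1 : Vᗮ.starProjection (Vᗮ.starProjection x) = Vᗮ.starProjection x :=
    starProjection_eq_self_iff.2 (starProjection_apply_mem _ _)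
  have h2 : Vᗮ.starProjection (V.starProjection x) = 0 :=
    (starProjection_apply_eq_zero_iff _).2 (V.le_orthogonal_orthogonal (starProjection_apply_mem _ _))
  rw [orthogonalScaling_apply, map_add, map_smul, map_smul, h1, h2, smul_zero, zero_add]

theorem det_orthogonalScaling (V : Submodule ℝ E) (α β : ℝ) :
    LinearMap.det (orthogonalScaling V α β) = α ^ finrank ℝ V * β ^ finrank ℝ Vᗮ := by
  let e := V.prodEquivOfIsCompl Vᗮ (isCompl_orthogonal V)
  have h : orthogonalScaling V α β = (e : (V × Vᗮ) →ₗ[ℝ] E) ∘ₗ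
      ((α • LinearMap.id).prodMap (β • LinearMap.id)) ∘ₗ (e.symm : E →ₗ[ℝ] V × Vᗮ) := by
    ext x
    obtain ⟨⟨v, w⟩, rfl⟩ := e.surjective x
    have h1 : V.starProjection (v : E) = v := starProjection_eq_self_iff.2 v.2
    have h2 : Vᗮ.starProjection (w : E) = w := starProjection_eq_self_iff.2 w.2
    have h3 : V.starProjection (w : E) = 0 := (starProjection_apply_eq_zero_iff _).2 w.2
    have h4 : Vᗮ.starProjection (v : E) = 0 :=
      (starProjection_apply_eq_zero_iff _).2 (V.le_orthogonal_orthogonal v.2)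
    simp [e, orthogonalScaling_apply, h1, h3]
  rw [h, LinearMap.det_conj, LinearMap.det_prodMap, LinearMap.det_smul, LinearMap.det_smul]
  simp

variable [MeasurableSpace E] [BorelSpace E] (μ : Measure E) [μ.IsAddHaarMeasure]

theorem lintegral_comp_orthogonalScaling (V : Submodule ℝ E) {α β : ℝ} (hα : 0 < α) (hβ : 0 < β)
    {f : E → ℝ≥0∞} (hf : Measurable f) :
    ∫⁻ x, f x ∂μ = ENNReal.ofReal (α ^ finrank ℝ V * β ^ finrank ℝ Vᗮ) *
      ∫⁻ x, f (orthogonalScaling V α β x) ∂μ := by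
  have hdet : 0 < α ^ finrank ℝ V * β ^ finrank ℝ Vᗮ := by positivity
  have h := Measure.map_linearMap_addHaar_eq_smul_addHaar μ (f := orthogonalScaling V α β)
    (by rw [det_orthogonalScaling]; exact hdet.ne')
  rw [← lintegral_map hf (LinearMap.continuous_of_finiteDimensional _).measurable, h,
    lintegral_smul_measure, det_orthogonalScaling, abs_of_pos (inv_pos.2 hdet), smul_eq_mul,
    ← mul_assoc, ← ENNReal.ofReal_mul hdet.le, mul_inv_cancel₀ hdet.ne', ENNReal.ofReal_one, one_mul]

omit [InnerProductSpace ℝ E] [FiniteDimensional ℝ E] in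
-- Haar measure is a multiple of the Hausdorff measure of top dimension, which 1-Lipschitz maps do
-- not increase.
theorem LipschitzWith.addHaar_image_le [NormedSpace ℝ E] [FiniteDimensional ℝ E] {f : E → E}
    (hf : LipschitzWith 1 f) (s : Set E) : μ (f '' s) ≤ μ s := by
  have h := Measure.isAddLeftInvariant_eq_smul μ μH[finrank ℝ E]
  rw [h]
  have h2 := hf.hausdorffMeasure_image_le (Nat.cast_nonneg (finrank ℝ E)) s
  simp only [ENNReal.coe_one, ENNReal.one_rpow, one_mul] at h2
  simp only [Measure.smul_apply]
  gcongr

end OrthogonalScaling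

/-! ### Volume expansion of the dilation along normals. -/

section RayDilation

variable {E : Type*} [NormedAddCommGroup E] [InnerProductSpace ℝ E] [FiniteDimensional ℝ E]
  {K : Set E} {P : E → E}

/-- With `θ = s⁻¹` this map is one factor of the inverse of the ray dilation. The increment of `P`
lies in `V` and is no longer than the `V`-component of the increment of the argument; so is their
convex combination, and Pythagoras concludes. -/
theorem IsNearestPointMap.lipschitzWith_homotopy (hP : IsNearestPointMap K P) {θ : ℝ}
    (h0 : 0 ≤ θ) (h1 : θ ≤ 1) :
    LipschitzWith 1 fun z => (1 - θ) • P z + θ • (vectorSpan ℝ K).starProjection z +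
      (vectorSpan ℝ K)ᗮ.starProjection z := by
  set V := vectorSpan ℝ K
  refine LipschitzWith.of_dist_le_mul fun x y => ?_
  rw [dist_eq_norm, dist_eq_norm, NNReal.coe_one, one_mul]
  set u := V.starProjection (x - y) with hu
  set w := Vᗮ.starProjection (x - y) with hw
  set q := P x - P y with hq
  have hqV : q ∈ V := hP.sub_mem_vectorSpan x y
  have huV : u ∈ V := starProjection_apply_mem _ _
  have hwV : w ∈ Vᗮ := starProjection_apply_mem _ _
  have hsum : x - y = u + w := (V.starProjection_add_starProjection_orthogonal (x - y)).symm
  have hqu : ‖q‖ ≤ ‖u‖ := by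
    have h := hP.sq_norm_sub_le x y
    rw [hsum, inner_add_left, real_inner_comm q w, V.mem_orthogonal _ |>.1 hwV _ hqV, add_zero] at h
    have h' := h.trans (real_inner_le_norm _ _)
    rcases (norm_nonneg q).eq_or_lt with h0 | h0
    · rw [← h0]
      exact norm_nonneg _
    · change ‖q‖ ^ 2 ≤ _ at h'
      change ‖u‖ * ‖q‖ ≥ _ at h'
      nlinarith
  have hdiff : (1 - θ) • P x + θ • V.starProjection x + Vᗮ.starProjection x -
      ((1 - θ) • P y + θ • V.starProjection y + Vᗮ.starProjection y) =
      ((1 - θ) • q + θ • u) + w := by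
    rw [hu, hw, hq, map_sub, map_sub]
    module
  have hpyth : ∀ v ∈ V, ‖v + w‖ ^ 2 = ‖v‖ ^ 2 + ‖w‖ ^ 2 := fun v hv => by
    rw [norm_add_sq_real, V.mem_orthogonal _ |>.1 hwV _ hv]
    ring
  have hle : ‖(1 - θ) • q + θ • u‖ ≤ ‖u‖ := by
    refine (norm_add_le _ _).trans ?_
    rw [norm_smul, norm_smul, Real.norm_of_nonneg h0, Real.norm_of_nonneg (by linarith)]
    nlinarith
  rw [hdiff, hsum]
  refine le_of_sq_le_sq ?_ (norm_nonneg _)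
  rw [hpyth _ (V.add_mem (V.smul_mem _ hqV) (V.smul_mem _ huV)), hpyth _ huV]
  gcongr

variable [MeasurableSpace E] [BorelSpace E] (μ : Measure E) [μ.IsAddHaarMeasure]

/-- Dilating by `s ≥ 1` along the normals of a convex set expands volumes by at least
`s ^ codim K`. -/
theorem IsNearestPointMap.lintegral_ray_le (hP : IsNearestPointMap K P) {s : ℝ} (hs : 1 ≤ s)
    {f : E → ℝ≥0∞} (hf : Measurable f) :
    ∫⁻ x, f (P x + s • (x - P x)) ∂μ ≤
      ENNReal.ofReal (s⁻¹ ^ finrank ℝ (vectorSpan ℝ K)ᗮ) * ∫⁻ x, f x ∂μ := by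
  set V := vectorSpan ℝ K
  have hs0 : 0 < s := by linarith
  have hPc := hP.continuous
  have hF : Measurable fun x => P x + s • (x - P x) := by
    have : Continuous fun x => P x + s • (x - P x) := by fun_prop
    exact this.measurable
  have hle : Measure.map (fun x => P x + s • (x - P x)) μ ≤
      ENNReal.ofReal (s⁻¹ ^ finrank ℝ Vᗮ) • μ := by
    refine Measure.le_iff.2 fun A hA => ?_
    rw [Measure.map_apply hF hA, Measure.smul_apply, smul_eq_mul]
    -- Recover `x` from its dilate `y`: shrinking the `Vᗮ`-part of `y` by `s⁻¹` gives `z` with `P z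
    -- = P x`, and the homotopy sends `z` to `(1 - s⁻¹) P x + s⁻¹ y = x`. The volume factor comes
    -- from the linear map alone.
    have hsub : (fun x => P x + s • (x - P x)) ⁻¹' A ⊆
        (fun z => (1 - s⁻¹) • P z + s⁻¹ • V.starProjection z + Vᗮ.starProjection z) ''
          (orthogonalScaling V 1 s⁻¹ '' A) := by
      intro x hx
      refine ⟨_, ⟨_, hx, rfl⟩, ?_⟩
      dsimp only
      rw [starProjection_orthogonalScaling, orthogonal_starProjection_orthogonalScaling]
      set y := P x + s • (x - P x) with hy
      have hPy : P (orthogonalScaling V 1 s⁻¹ y) = P x := by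
        rw [← hP.apply_ray x hs0.le, ← hy]
        refine hP.apply_eq_of_sub_mem_orthogonal ?_
        have h1 : orthogonalScaling V 1 s⁻¹ y - y = (s⁻¹ - 1) • Vᗮ.starProjection y := by
          conv_lhs => rw [orthogonalScaling_apply]
          nth_rewrite 3 [← V.starProjection_add_starProjection_orthogonal y]
          module
        rw [h1]
        exact smul_mem _ _ (starProjection_apply_mem _ _)
      have h2 := V.starProjection_add_starProjection_orthogonal y
      rw [hPy, one_smul, add_assoc, ← smul_add, h2, hy, smul_add, smul_smul,
        inv_mul_cancel₀ hs0.ne', sub_smul]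
      abel_nf
      simp
    refine (measure_mono hsub).trans ((LipschitzWith.addHaar_image_le μ
      (hP.lipschitzWith_homotopy (inv_nonneg.2 hs0.le) (inv_le_one_of_one_le₀ hs)) _).trans_eq ?_)
    rw [Measure.addHaar_image_linearMap, det_orthogonalScaling, one_pow, one_mul,
      abs_of_pos (by positivity)]
  rw [← lintegral_map hf hF]
  refine (lintegral_mono' hle le_rfl).trans_eq ?_
  rw [lintegral_smul_measure, smul_eq_mul]

end RayDilation

/-! ### One-dimensional inequalities along a ray. -/

section OneDimensional

theorem MeasureTheory.rpow_lintegral_le_lintegral_rpow {α : Type*} [MeasurableSpace α]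
    (ρ : Measure α) [IsProbabilityMeasure ρ] {p : ℝ} (hp : 1 ≤ p) {f : α → ℝ≥0∞}
    (hf : AEMeasurable f ρ) : (∫⁻ x, f x ∂ρ) ^ p ≤ ∫⁻ x, f x ^ p ∂ρ := by
  have h := eLpNorm'_le_eLpNorm'_of_exponent_le one_pos hp ρ hf.aestronglyMeasurable
  simp only [eLpNorm', enorm_eq_self, ENNReal.rpow_one, div_one] at h
  calc (∫⁻ x, f x ∂ρ) ^ p ≤ ((∫⁻ x, f x ^ p ∂ρ) ^ (1 / p)) ^ p := by gcongr
    _ = _ := by rw [← ENNReal.rpow_mul, one_div_mul_cancel (by linarith), ENNReal.rpow_one]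

theorem lintegral_Ioi_one_rpow {a : ℝ} (ha : 0 < a) :
    ∫⁻ s in Ioi (1 : ℝ), ENNReal.ofReal (s ^ (-1 - a)) = ENNReal.ofReal a⁻¹ := by
  have h1 : -1 - a < -1 := by linarith
  rw [← ofReal_integral_eq_lintegral_ofReal (integrableOn_Ioi_rpow_of_lt h1 one_pos),
    integral_Ioi_rpow_of_lt h1 one_pos]
  · congr 1
    rw [Real.one_rpow, show -1 - a + 1 = -a by ring, neg_div_neg_eq, one_div]
  · filter_upwards [ae_restrict_mem measurableSet_Ioi] with s hs
    exact Real.rpow_nonneg (zero_le_one.trans (le_of_lt hs)) _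

/-- Hölder's inequality on `(1, ∞)` against the power weight of exponent `-1 - a`. -/
theorem rpow_lintegral_Ioi_one_le {a p : ℝ} (ha : 0 < a) (hp : 1 ≤ p) {g : ℝ → ℝ≥0∞}
    (hg : Measurable g) :
    (∫⁻ s in Ioi (1 : ℝ), g s) ^ p ≤ ENNReal.ofReal (a ^ (1 - p)) *
      ∫⁻ s in Ioi (1 : ℝ), ENNReal.ofReal (s ^ ((1 + a) * (p - 1))) * g s ^ p := by
  -- `w` is a probability density on `(1, ∞)` and `v` its reciprocal, so Jensen applies to `v * g`.
  let w : ℝ → ℝ≥0∞ := fun s => ENNReal.ofReal (a * s ^ (-1 - a))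
  let v : ℝ → ℝ≥0∞ := fun s => ENNReal.ofReal (a⁻¹ * s ^ (1 + a))
  have hw : Measurable w := by fun_prop
  have hv : Measurable v := by fun_prop
  have hprob : IsProbabilityMeasure ((volume.restrict (Ioi (1 : ℝ))).withDensity w) := by
    constructor
    rw [withDensity_apply _ MeasurableSet.univ, Measure.restrict_univ]
    simp only [w, ENNReal.ofReal_mul ha.le]
    rw [lintegral_const_mul _ (by fun_prop), lintegral_Ioi_one_rpow ha, ← ENNReal.ofReal_mul ha.le,
      mul_inv_cancel₀ ha.ne', ENNReal.ofReal_one]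
  have h := rpow_lintegral_le_lintegral_rpow ((volume.restrict (Ioi (1 : ℝ))).withDensity w) hp
    (f := fun s => v s * g s) (hv.mul hg).aemeasurable
  rw [lintegral_withDensity_eq_lintegral_mul _ hw (show Measurable fun s => v s * g s by fun_prop),
    lintegral_withDensity_eq_lintegral_mul _ hw
      (show Measurable fun s => (v s * g s) ^ p by fun_prop)] at h
  have e1 : ∫⁻ s in Ioi (1 : ℝ), (w * fun s => v s * g s) s = ∫⁻ s in Ioi (1 : ℝ), g s := by
    refine setLIntegral_congr_fun measurableSet_Ioi fun s hs => ?_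
    have hs0 : 0 < s := zero_lt_one.trans hs
    simp only [Pi.mul_apply, w, v]
    rw [← mul_assoc, ← ENNReal.ofReal_mul (by positivity),
      show a * s ^ (-1 - a) * (a⁻¹ * s ^ (1 + a)) = (a * a⁻¹) * (s ^ (-1 - a) * s ^ (1 + a)) by ring,
      mul_inv_cancel₀ ha.ne', ← Real.rpow_add hs0, show -1 - a + (1 + a) = 0 by ring,
      Real.rpow_zero, one_mul, ENNReal.ofReal_one, one_mul]
  have e2 : ∫⁻ s in Ioi (1 : ℝ), (w * fun s => (v s * g s) ^ p) s =
      ENNReal.ofReal (a ^ (1 - p)) *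
      ∫⁻ s in Ioi (1 : ℝ), ENNReal.ofReal (s ^ ((1 + a) * (p - 1))) * g s ^ p := by
    rw [← lintegral_const_mul _ (by fun_prop)]
    refine setLIntegral_congr_fun measurableSet_Ioi fun s hs => ?_
    have hs0 : 0 < s := zero_lt_one.trans hs
    simp only [Pi.mul_apply, w, v]
    rw [ENNReal.mul_rpow_of_nonneg _ _ (by linarith), ENNReal.ofReal_rpow_of_pos (by positivity),
      ← mul_assoc, ← ENNReal.ofReal_mul (by positivity), ← mul_assoc,
      ← ENNReal.ofReal_mul (by positivity)]
    congr 2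
    rw [Real.mul_rpow (by positivity) (by positivity), ← Real.rpow_mul hs0.le, Real.inv_rpow ha.le,
      ← Real.rpow_neg ha.le, show (1 + a) * (p - 1) = (-1 - a) + (1 + a) * p by ring,
      Real.rpow_add hs0, sub_eq_add_neg 1 p, Real.rpow_add ha, Real.rpow_one]
    ring
  rwa [e1, e2] at h

variable {E : Type*} [NormedAddCommGroup E] [NormedSpace ℝ E]

/-- Fundamental theorem of calculus from infinity, where `φ` vanishes; `y ≠ 0` makes the ray leave
the support. The proof runs along `t = -s`, so the endpoint `-1` corresponds to `q + y`. -/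
theorem HasCompactSupport.enorm_le_lintegral_ray {φ : E → ℝ} (hφ : ContDiff ℝ 1 φ)
    (hc : HasCompactSupport φ) (q : E) {y : E} (hy : y ≠ 0) :
    ‖φ (q + y)‖ₑ ≤ ‖y‖ₑ * ∫⁻ s in Ioi (1 : ℝ), ‖fderiv ℝ φ (q + s • y)‖ₑ := by
  have hcont : Continuous fun s : ℝ => ‖fderiv ℝ φ (q + s • y)‖ₑ :=
    ((hφ.continuous_fderiv one_ne_zero).comp (by fun_prop)).enorm
  have hcd : ContDiff ℝ 1 fun t : ℝ => φ (q - t • y) := hφ.comp (by fun_prop)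
  have hemb : Topology.IsClosedEmbedding fun t : ℝ => q - t • y := by
    have h := (Homeomorph.subLeft q).isClosedEmbedding.comp (isClosedEmbedding_smul_left (𝕜 := ℝ) hy)
    exact h
  have hcs : HasCompactSupport fun t : ℝ => φ (q - t • y) := hc.comp_isClosedEmbedding hemb
  have h := hcs.enorm_le_lintegral_Ici_deriv hcd (-1)
  have hderiv : ∀ t : ℝ, ‖deriv (fun t : ℝ => φ (q - t • y)) t‖ₑ ≤
      ‖y‖ₑ * ‖fderiv ℝ φ (q - t • y)‖ₑ := fun t => by
    have h1 : HasDerivAt (fun t : ℝ => q - t • y) (-y) t := by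
      simpa using ((hasDerivAt_id t).smul_const y).const_sub q
    have h2 := ((hφ.differentiable one_ne_zero) (q - t • y)).hasFDerivAt.comp_hasDerivAt t h1
    have h3 : deriv (fun t : ℝ => φ (q - t • y)) t = fderiv ℝ φ (q - t • y) (-y) := h2.deriv
    rw [h3, map_neg, enorm_neg, mul_comm]
    exact ContinuousLinearMap.le_opENorm _ _
  rw [show q - (-1 : ℝ) • y = q + y by module] at h
  refine h.trans ((lintegral_mono hderiv).trans_eq ?_)
  have hpre := (Measure.measurePreserving_neg (volume : Measure ℝ)).setLIntegral_comp_preimage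
    (s := Iic (-1)) measurableSet_Iic (f := fun t => ‖y‖ₑ * ‖fderiv ℝ φ (q - t • y)‖ₑ)
    (by
      have : Continuous fun t : ℝ => ‖fderiv ℝ φ (q - t • y)‖ₑ :=
        ((hφ.continuous_fderiv one_ne_zero).comp (by fun_prop)).enorm
      exact this.measurable.const_mul _)
  rw [← hpre, ← lintegral_const_mul _ hcont.measurable, show (Neg.neg ⁻¹' Iic (-1) : Set ℝ) = Ici 1
    by ext; simp, setLIntegral_congr Ioi_ae_eq_Ici]
  simp

end OneDimensional

/-! ### The weight under dilation. -/

section Weight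

theorem hardyWeight_pos (δ δ' : ℝ) {r : ℝ} (hr : 0 < r) : 0 < hardyWeight δ δ' r :=
  mul_pos (Real.rpow_pos_of_pos hr _) (Real.rpow_pos_of_pos (by linarith) _)

theorem measurable_hardyWeight (δ δ' : ℝ) : Measurable (hardyWeight δ δ') := by
  unfold hardyWeight
  fun_prop

/-- Here `δ ≤ δ'` enters the lower bound: it makes `(1 + r) ^ (δ' - δ)` nondecreasing in `r`. -/
theorem hardyWeight_le_mul {δ δ' r s : ℝ} (h : δ ≤ δ') (hr : 0 < r) (hs : 1 ≤ s) :
    hardyWeight δ δ' r ≤ s ^ (-δ) * hardyWeight δ δ' (s * r) := by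
  have hs0 : 0 < s := by linarith
  unfold hardyWeight
  rw [Real.mul_rpow hs0.le hr.le, ← mul_assoc, ← mul_assoc, ← Real.rpow_add hs0, neg_add_cancel,
    Real.rpow_zero, one_mul]
  have h1 : (1 + r) ^ (δ' - δ) ≤ (1 + s * r) ^ (δ' - δ) :=
    Real.rpow_le_rpow (by linarith) (by nlinarith) (by linarith)
  gcongr

end Weight

/-! ### The Hardy inequality with the sharp constant. -/

section LowerBound

variable {E : Type*} [NormedAddCommGroup E] [InnerProductSpace ℝ E] [FiniteDimensional ℝ E]
  [MeasurableSpace E] [BorelSpace E]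

/-- The weighted Hardy inequality on the complement of a closed convex set, in the case
`δ ≤ δ'`. -/
theorem lintegral_hardy_le {K : Set E} (hc : IsClosed K) (hK : Convex ℝ K) (hne : K.Nonempty)
    (μ : Measure E) [μ.IsAddHaarMeasure] {δ δ' p a : ℝ} (hδ : δ ≤ δ') (hp : 1 ≤ p) (ha : 0 < a)
    (hap : a * p = finrank ℝ (vectorSpan ℝ K)ᗮ + δ - p) {φ : E → ℝ} (hφ : ContDiff ℝ 1 φ)
    (hcs : HasCompactSupport φ) :
    ∫⁻ x in Kᶜ, ENNReal.ofReal (hardyWeight δ δ' (infDist x K) * infDist x K ^ (-p) * |φ x| ^ p) ∂μ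
      ≤ ENNReal.ofReal (a ^ (-p)) *
        ∫⁻ x in Kᶜ, ENNReal.ofReal (hardyWeight δ δ' (infDist x K) * ‖fderiv ℝ φ x‖ ^ p) ∂μ := by
  obtain ⟨P, hP⟩ := hK.exists_isNearestPointMap hc hne
  have hPc := hP.continuous
  have hp0 : 0 ≤ p := by linarith
  set n := finrank ℝ (vectorSpan ℝ K)ᗮ
  let G : E → ℝ≥0∞ := fun x =>
    ENNReal.ofReal (hardyWeight δ δ' (infDist x K) * ‖fderiv ℝ φ x‖ ^ p)
  have hfd : Measurable fun x => ‖fderiv ℝ φ x‖ := (hφ.continuous_fderiv one_ne_zero).norm.measurable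
  have hG : Measurable G :=
    (((measurable_hardyWeight δ δ').comp measurable_infDist).mul (hfd.pow_const p)).ennreal_ofReal
  let h : E → ℝ≥0∞ := Kᶜ.indicator G
  have hh : Measurable h := hG.indicator hc.measurableSet.compl
  let F : ℝ → E → E := fun s x => P x + s • (x - P x)
  let m : ℝ → ℝ≥0∞ := fun s => ENNReal.ofReal (s ^ ((1 + a) * (p - 1) - δ))
  have hm : Measurable m := by fun_prop
  have hpt : ∀ x ∈ Kᶜ, ENNReal.ofReal
      (hardyWeight δ δ' (infDist x K) * infDist x K ^ (-p) * |φ x| ^ p) ≤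
      ENNReal.ofReal (a ^ (1 - p)) * ∫⁻ s in Ioi (1 : ℝ), m s * h (F s x) := by
    intro x hx
    have hr : 0 < infDist x K := (hc.notMem_iff_infDist_pos hne).1 hx
    set r := infDist x K with hrdef
    have hrn : ‖x - P x‖ = r := (hP.infDist_eq x).symm
    have hy : x - P x ≠ 0 := by
      rw [← norm_pos_iff, hrn]
      exact hr
    have hray := hcs.enorm_le_lintegral_ray hφ (P x) hy
    rw [add_sub_cancel] at hray
    let g : ℝ → ℝ≥0∞ := fun s => ‖fderiv ℝ φ (P x + s • (x - P x))‖ₑ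
    have hg : Measurable g :=
      ((hφ.continuous_fderiv one_ne_zero).comp (by fun_prop)).enorm.measurable
    have hw := hardyWeight_pos δ δ' hr
    calc ENNReal.ofReal (hardyWeight δ δ' r * r ^ (-p) * |φ x| ^ p)
        = ENNReal.ofReal (hardyWeight δ δ' r) * (ENNReal.ofReal (r ^ (-p)) * ‖φ x‖ₑ ^ p) := by
          rw [mul_assoc, ENNReal.ofReal_mul hw.le, ENNReal.ofReal_mul (by positivity),
            ← ENNReal.ofReal_rpow_of_nonneg (abs_nonneg _) hp0, ← Real.norm_eq_abs,
            ofReal_norm]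
      _ ≤ ENNReal.ofReal (hardyWeight δ δ' r) * (∫⁻ s in Ioi (1 : ℝ), g s) ^ p := by
          refine mul_le_mul_right ?_ _
          calc ENNReal.ofReal (r ^ (-p)) * ‖φ x‖ₑ ^ p
              ≤ ENNReal.ofReal (r ^ (-p)) * (‖x - P x‖ₑ * ∫⁻ s in Ioi (1 : ℝ), g s) ^ p := by
                gcongr
            _ = (∫⁻ s in Ioi (1 : ℝ), g s) ^ p := by
                rw [ENNReal.mul_rpow_of_nonneg _ _ hp0, ← mul_assoc, ← ofReal_norm, hrn,
                  ENNReal.ofReal_rpow_of_pos hr, ← ENNReal.ofReal_mul (by positivity),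
                  ← Real.rpow_add hr, neg_add_cancel, Real.rpow_zero, ENNReal.ofReal_one, one_mul]
      _ ≤ ENNReal.ofReal (hardyWeight δ δ' r) * (ENNReal.ofReal (a ^ (1 - p)) *
          ∫⁻ s in Ioi (1 : ℝ), ENNReal.ofReal (s ^ ((1 + a) * (p - 1))) * g s ^ p) := by
          gcongr
          exact rpow_lintegral_Ioi_one_le ha hp hg
      _ = ENNReal.ofReal (a ^ (1 - p)) * ∫⁻ s in Ioi (1 : ℝ), ENNReal.ofReal (hardyWeight δ δ' r) *
          (ENNReal.ofReal (s ^ ((1 + a) * (p - 1))) * g s ^ p) := by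
          rw [lintegral_const_mul _ (by fun_prop)]
          ring
      _ ≤ ENNReal.ofReal (a ^ (1 - p)) * ∫⁻ s in Ioi (1 : ℝ), m s * h (F s x) := by
          refine mul_le_mul_right ?_ _
          refine setLIntegral_mono' measurableSet_Ioi fun s hs => ?_
          have hs0 : 0 < s := zero_lt_one.trans hs
          have hdist : infDist (F s x) K = s * r := hP.infDist_ray x hs0.le
          have hmem : F s x ∈ Kᶜ := (hc.notMem_iff_infDist_pos hne).2 (by rw [hdist]; positivity)
          have hw' := hardyWeight_pos δ δ' (mul_pos hs0 hr)
          simp only [h, indicator_of_mem hmem, G, hdist, m, g]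
          rw [← ofReal_norm, ENNReal.ofReal_rpow_of_nonneg (norm_nonneg _) hp0,
            ← ENNReal.ofReal_mul (by positivity), ← ENNReal.ofReal_mul hw.le,
            ← ENNReal.ofReal_mul (by positivity)]
          refine ENNReal.ofReal_le_ofReal ?_
          change hardyWeight δ δ' r * (s ^ ((1 + a) * (p - 1)) * ‖fderiv ℝ φ (F s x)‖ ^ p) ≤
            s ^ ((1 + a) * (p - 1) - δ) * (hardyWeight δ δ' (s * r) * ‖fderiv ℝ φ (F s x)‖ ^ p)
          rw [sub_eq_add_neg _ δ, Real.rpow_add hs0]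
          calc hardyWeight δ δ' r * (s ^ ((1 + a) * (p - 1)) * ‖fderiv ℝ φ (F s x)‖ ^ p)
              ≤ (s ^ (-δ) * hardyWeight δ δ' (s * r)) *
                (s ^ ((1 + a) * (p - 1)) * ‖fderiv ℝ φ (F s x)‖ ^ p) := by
                gcongr
                exact hardyWeight_le_mul hδ hr (le_of_lt hs)
            _ = _ := by ring
  have hFm : Measurable fun z : E × ℝ => m z.2 * h (F z.2 z.1) := by
    have hFc : Continuous fun z : E × ℝ => F z.2 z.1 := by
      simp only [F]
      fun_prop
    exact (hm.comp measurable_snd).mul (hh.comp hFc.measurable)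
  calc ∫⁻ x in Kᶜ, ENNReal.ofReal
        (hardyWeight δ δ' (infDist x K) * infDist x K ^ (-p) * |φ x| ^ p) ∂μ
      ≤ ∫⁻ x in Kᶜ, ENNReal.ofReal (a ^ (1 - p)) * (∫⁻ s in Ioi (1 : ℝ), m s * h (F s x)) ∂μ :=
        setLIntegral_mono' hc.measurableSet.compl hpt
    _ ≤ ∫⁻ x, ENNReal.ofReal (a ^ (1 - p)) * (∫⁻ s in Ioi (1 : ℝ), m s * h (F s x)) ∂μ :=
        setLIntegral_le_lintegral _ _
    _ = ENNReal.ofReal (a ^ (1 - p)) * ∫⁻ s in Ioi (1 : ℝ), ∫⁻ x, m s * h (F s x) ∂μ := by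
        rw [lintegral_const_mul _ hFm.lintegral_prod_right', lintegral_lintegral_swap hFm.aemeasurable]
    _ ≤ ENNReal.ofReal (a ^ (1 - p)) *
        ∫⁻ s in Ioi (1 : ℝ), ENNReal.ofReal (s ^ (-1 - a)) * ∫⁻ x, h x ∂μ := by
        gcongr ENNReal.ofReal (a ^ (1 - p)) * ?_
        refine setLIntegral_mono' measurableSet_Ioi fun s hs => ?_
        have hs0 : 0 < s := zero_lt_one.trans hs
        have hFc : Continuous (F s) := by
          simp only [F]
          fun_prop
        rw [lintegral_const_mul (m s) (f := fun x => h (F s x)) (hh.comp hFc.measurable)]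
        calc m s * ∫⁻ x, h (F s x) ∂μ
            ≤ m s * (ENNReal.ofReal (s⁻¹ ^ n) * ∫⁻ x, h x ∂μ) := by
              gcongr
              exact hP.lintegral_ray_le μ (le_of_lt hs) hh
          _ = ENNReal.ofReal (s ^ (-1 - a)) * ∫⁻ x, h x ∂μ := by
              rw [← mul_assoc, ← ENNReal.ofReal_mul (by positivity), ← Real.rpow_natCast,
                Real.inv_rpow hs0.le, ← Real.rpow_neg hs0.le, ← Real.rpow_add hs0]
              congr 3
              -- By `hap`, `(1 + a)(p - 1) - δ - n = -1 - a`.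
              linarith
    _ = ENNReal.ofReal (a ^ (-p)) * ∫⁻ x in Kᶜ, G x ∂μ := by
        rw [lintegral_mul_const _ (by fun_prop), lintegral_Ioi_one_rpow ha,
          lintegral_indicator hc.measurableSet.compl, ← mul_assoc,
          ← ENNReal.ofReal_mul (by positivity), sub_eq_add_neg 1 p, Real.rpow_add ha, Real.rpow_one,
          mul_right_comm, mul_inv_cancel₀ ha.ne', one_mul]

end LowerBound

/-! ### Distance near a relatively interior point. -/

section RelativeInterior

variable {E : Type*} [NormedAddCommGroup E] [InnerProductSpace ℝ E] [FiniteDimensional ℝ E]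

/-- Near a relatively interior point of a convex set, the distance to the set is the distance to
its affine span. -/
theorem Convex.exists_infDist_eq_norm_starProjection {K : Set E} (hK : Convex ℝ K)
    (hc : IsClosed K) (hne : K.Nonempty) : ∃ x₀ : E, ∃ ρ > 0, ∀ x,
      ‖(vectorSpan ℝ K).starProjection (x - x₀)‖ < ρ →
        infDist x K = ‖(vectorSpan ℝ K)ᗮ.starProjection (x - x₀)‖ := by
  obtain ⟨x₀, hx₀⟩ := (intrinsicInterior_nonempty hK).mpr hne
  obtain ⟨y, hy, rfl⟩ := mem_intrinsicInterior.1 hx₀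
  obtain ⟨ρ, hρ, hball⟩ := Metric.mem_nhds_iff.1 (mem_interior_iff_mem_nhds.1 hy)
  obtain ⟨P, hP⟩ := hK.exists_isNearestPointMap hc hne
  refine ⟨y, ρ, hρ, fun x hx => ?_⟩
  set V := vectorSpan ℝ K with hV
  set v := V.starProjection (x - y) with hv
  have hvV : v ∈ V := starProjection_apply_mem _ _
  have hmem : v + (y : E) ∈ affineSpan ℝ K := by
    refine AffineSubspace.vadd_mem_of_mem_direction ?_ y.2
    rwa [direction_affineSpan]
  have hz : v + (y : E) ∈ K := by
    have : (⟨v + y, hmem⟩ : affineSpan ℝ K) ∈ ball y ρ := by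
      rw [mem_ball, Subtype.dist_eq, dist_eq_norm]
      simpa using hx
    exact hball this
  have hsub : x - (v + y) = Vᗮ.starProjection (x - y) := by
    have := V.starProjection_add_starProjection_orthogonal (x - y)
    rw [← hv] at this
    rw [eq_sub_of_add_eq' this]
    abel
  -- The orthogonal projection of `x` to the affine span lands in `K`, and the residual is
  -- orthogonal to `V`, so the variational inequality holds with equality.
  have hPx : P x = v + y := by
    refine hP.eq_of_inner_le hz fun z hzK => ?_
    rw [hsub, real_inner_comm]
    exact (V.mem_orthogonal _ |>.1 (starProjection_apply_mem _ _) _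
      (vsub_mem_vectorSpan ℝ hzK hz)).le
  rw [hP.infDist_eq, hPx, hsub]

end RelativeInterior

/-! ### Logarithmically cut-off test functions. -/

section TestFunction

/-- A power `r ^ (-a)` cut off on the logarithmic scale. -/
noncomputable def logCutoffPower (w : ℝ → ℝ) (a N r : ℝ) : ℝ :=
  r ^ (-a) * w (Real.log r / N)

theorem hasDerivAt_logCutoffPower {w : ℝ → ℝ} (hw : ContDiff ℝ 1 w) (a N : ℝ) {r : ℝ} (hr : 0 < r) :
    HasDerivAt (logCutoffPower w a N)
      (r ^ (-a - 1) * (-a * w (Real.log r / N) + deriv w (Real.log r / N) / N)) r := by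
  have h1 : HasDerivAt (fun r : ℝ => r ^ (-a)) (-a * r ^ (-a - 1)) r :=
    Real.hasDerivAt_rpow_const (Or.inl hr.ne')
  have h2 : HasDerivAt (fun r : ℝ => Real.log r / N) (r⁻¹ / N) r :=
    (Real.hasDerivAt_log hr.ne').div_const N
  have h3 := (hw.differentiable one_ne_zero (Real.log r / N)).hasDerivAt.comp r h2
  have h4 := h1.mul h3
  refine h4.congr_deriv ?_
  rw [show r ^ (-a) = r ^ (-a - 1) * r by
    rw [← Real.rpow_add_one hr.ne']; congr 1; ring]
  simp only [Function.comp_apply]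
  field_simp

variable {E : Type*} [NormedAddCommGroup E] [InnerProductSpace ℝ E] [FiniteDimensional ℝ E]

/-- The points at distance at most `R` from `x₀` along `V`, whose distance to `x₀ + V` lies in
`[b, c]`. -/
def cylinderShell (V : Submodule ℝ E) (x₀ : E) (R b c : ℝ) : Set E :=
  {x | ‖V.starProjection (x - x₀)‖ ≤ R ∧ ‖Vᗮ.starProjection (x - x₀)‖ ∈ Icc b c}

theorem isClosed_cylinderShell (V : Submodule ℝ E) (x₀ : E) (R b c : ℝ) :
    IsClosed (cylinderShell V x₀ R b c) := by
  have h : Continuous fun x => ‖V.starProjection (x - x₀)‖ := by fun_prop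
  refine (isClosed_le h continuous_const).inter ?_
  exact isClosed_Icc.preimage (f := fun x => ‖Vᗮ.starProjection (x - x₀)‖) (by fun_prop)

theorem isCompact_cylinderShell (V : Submodule ℝ E) (x₀ : E) (R b c : ℝ) :
    IsCompact (cylinderShell V x₀ R b c) := by
  refine Metric.isCompact_of_isClosed_isBounded (isClosed_cylinderShell V x₀ R b c) ?_
  refine (isBounded_closedBall (x := x₀) (r := R + c)).subset fun x hx => ?_
  rw [mem_closedBall, dist_eq_norm, ← V.starProjection_add_starProjection_orthogonal (x - x₀)]
  exact (norm_add_le _ _).trans (add_le_add hx.1 hx.2.2)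

/-- A bump function along `V` times a cut-off power of the distance to `x₀ + V`. -/
noncomputable def cylinderTest (V : Submodule ℝ E) (x₀ : E) (χ : E → ℝ) (w : ℝ → ℝ) (a N : ℝ)
    (x : E) : ℝ :=
  χ (V.starProjection (x - x₀)) * logCutoffPower w a N ‖Vᗮ.starProjection (x - x₀)‖

variable {V : Submodule ℝ E} {x₀ : E} {χ : E → ℝ} {w : ℝ → ℝ} {a N R : ℝ}

theorem support_cylinderTest_subset (hχ : ∀ v, R < ‖v‖ → χ v = 0)
    (hw : ∀ t, t ∉ Icc (-4) (-1) → w t = 0) (hN : 0 < N) :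
    Function.support (cylinderTest V x₀ χ w a N) ⊆
      cylinderShell V x₀ R (Real.exp (-4 * N)) (Real.exp (-N)) := by
  intro x hx
  have h1 : χ (V.starProjection (x - x₀)) ≠ 0 := fun h =>
    hx (by rw [cylinderTest, h, zero_mul])
  have h2 : w (Real.log ‖Vᗮ.starProjection (x - x₀)‖ / N) ≠ 0 := fun h =>
    hx (by rw [cylinderTest, logCutoffPower, h, mul_zero, mul_zero])
  have h3 := not_imp_comm.1 (hw _) h2
  have hr : 0 < ‖Vᗮ.starProjection (x - x₀)‖ := by
    refine (norm_nonneg _).lt_of_ne fun h => ?_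
    -- On `x₀ + V` the convention `log 0 = 0` is harmless: `0 ∉ [-4, -1]`, so the cutoff vanishes.
    rw [← h, Real.log_zero, zero_div] at h3
    norm_num at h3
  refine ⟨not_lt.1 fun h => h1 (hχ _ h), ?_, ?_⟩
  · rw [← Real.le_log_iff_exp_le hr]
    exact (le_div_iff₀ hN).1 h3.1
  · rw [← Real.log_le_iff_le_exp hr]
    simpa using (div_le_iff₀ hN).1 h3.2

theorem tsupport_cylinderTest_subset (hχ : ∀ v, R < ‖v‖ → χ v = 0)
    (hw : ∀ t, t ∉ Icc (-4) (-1) → w t = 0) (hN : 0 < N) :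
    tsupport (cylinderTest V x₀ χ w a N) ⊆
      cylinderShell V x₀ R (Real.exp (-4 * N)) (Real.exp (-N)) :=
  closure_minimal (support_cylinderTest_subset hχ hw hN) (isClosed_cylinderShell _ _ _ _ _)

/-- On the closed support the distance to `x₀ + V` is positive, so every factor is `C^1`; elsewhere
the function is locally zero. -/
theorem contDiff_cylinderTest (hχ : ContDiff ℝ 1 χ) (hχR : ∀ v, R < ‖v‖ → χ v = 0)
    (hw : ContDiff ℝ 1 w) (hw0 : ∀ t, t ∉ Icc (-4) (-1) → w t = 0) (hN : 0 < N) :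
    ContDiff ℝ 1 (cylinderTest V x₀ χ w a N) := by
  refine contDiff_iff_contDiffAt.2 fun x => ?_
  by_cases hx : x ∈ tsupport (cylinderTest V x₀ χ w a N)
  · have hr : 0 < ‖Vᗮ.starProjection (x - x₀)‖ :=
      (Real.exp_pos _).trans_le (tsupport_cylinderTest_subset hχR hw0 hN hx).2.1
    have h1 : ContDiffAt ℝ 1 (fun x => ‖Vᗮ.starProjection (x - x₀)‖) x :=
      ContDiffAt.norm ℝ (by fun_prop) (norm_pos_iff.1 hr)
    have h2 : ContDiffAt ℝ 1 (fun x => χ (V.starProjection (x - x₀))) x :=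
      (hχ.comp (by fun_prop)).contDiffAt
    have h3 : ContDiffAt ℝ 1 (fun x => Real.log ‖Vᗮ.starProjection (x - x₀)‖ / N) x :=
      (h1.log hr.ne').div_const N
    exact h2.mul ((h1.rpow_const_of_ne hr.ne').mul (hw.contDiffAt.comp x h3))
  · have : cylinderTest V x₀ χ w a N =ᶠ[nhds x] fun _ => 0 :=
      notMem_tsupport_iff_eventuallyEq.1 hx
    exact contDiffAt_const.congr_of_eventuallyEq this

/-- Differentiating `r ^ (-a)` gives the main term. The derivative of `w` costs `r ^ (-a - 1) / N`;
that of `χ` costs only `r ^ (-a)`, which `r ≤ N⁻¹` turns into the same size. -/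
theorem norm_fderiv_cylinderTest_le {C₁ C₂ : NNReal} (hχ : ContDiff ℝ 1 χ)
    (hχ0 : ∀ v, 0 ≤ χ v) (hχ1 : ∀ v, χ v ≤ 1) (hχL : LipschitzWith C₁ χ)
    (hw : ContDiff ℝ 1 w) (hw0 : ∀ t, 0 ≤ w t) (hw1 : ∀ t, w t ≤ 1) (hwL : LipschitzWith C₂ w)
    (ha : 0 ≤ a) (hN : 0 < N) {x : E} {r : ℝ} (hr : r = ‖Vᗮ.starProjection (x - x₀)‖)
    (hr0 : 0 < r) (hrN : r ≤ N⁻¹) :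
    ‖fderiv ℝ (cylinderTest V x₀ χ w a N) x‖ ≤
      a * (cylinderTest V x₀ χ w a N x / r) + (C₁ + C₂) / N * r ^ (-a - 1) := by
  have hpow : r ^ (-a) = r ^ (-a - 1) * r := by
    rw [← Real.rpow_add_one hr0.ne']; congr 1; ring
  set X := χ (V.starProjection (x - x₀)) with hX
  set t := Real.log r / N with ht
  have hlip : ∀ U : Submodule ℝ E, LipschitzWith 1 fun x => U.starProjection (x - x₀) := fun U => by
    refine LipschitzWith.of_dist_le_mul fun y z => ?_
    rw [dist_eq_norm, dist_eq_norm, ← map_sub, NNReal.coe_one, one_mul,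
      sub_sub_sub_cancel_right]
    exact U.norm_starProjection_apply_le _
  have h1 : HasFDerivAt (fun x => χ (V.starProjection (x - x₀)))
      (fderiv ℝ (fun x => χ (V.starProjection (x - x₀))) x) x := by
    have : ContDiff ℝ 1 fun x => χ (V.starProjection (x - x₀)) := hχ.comp (by fun_prop)
    exact (this.differentiable one_ne_zero x).hasFDerivAt
  have h1n : ‖fderiv ℝ (fun x => χ (V.starProjection (x - x₀))) x‖ ≤ C₁ := by
    have := hχL.comp (hlip V)
    rw [mul_one] at this
    exact norm_fderiv_le_of_lipschitz ℝ this
  have h2 : HasFDerivAt (fun x => ‖Vᗮ.starProjection (x - x₀)‖)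
      (fderiv ℝ (fun x => ‖Vᗮ.starProjection (x - x₀)‖) x) x := by
    have hne : Vᗮ.starProjection (x - x₀) ≠ 0 := norm_pos_iff.1 (hr ▸ hr0)
    have : ContDiffAt ℝ 1 (fun x => ‖Vᗮ.starProjection (x - x₀)‖) x :=
      ContDiffAt.norm ℝ (by fun_prop) hne
    exact (this.differentiableAt one_ne_zero).hasFDerivAt
  have h2n : ‖fderiv ℝ (fun x => ‖Vᗮ.starProjection (x - x₀)‖) x‖ ≤ 1 := by
    have := lipschitzWith_one_norm.comp (hlip Vᗮ)
    rw [mul_one] at this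
    exact norm_fderiv_le_of_lipschitz ℝ this
  have h3 := (hasDerivAt_logCutoffPower hw a N (hr ▸ hr0)).comp_hasFDerivAt x h2
  rw [← hr] at h3
  have h4 := h1.mul h3
  have h5 : fderiv ℝ (cylinderTest V x₀ χ w a N) x = _ := h4.fderiv
  have hval : cylinderTest V x₀ χ w a N x = X * (r ^ (-a) * w t) := by
    rw [cylinderTest, logCutoffPower, ← hr]
  have hwd : |deriv w t| ≤ C₂ := by
    simpa using norm_deriv_le_of_lipschitz hwL (x₀ := t)
  have hrp : 0 < r ^ (-a - 1) := Real.rpow_pos_of_pos hr0 _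
  have hX0 : 0 ≤ X := hχ0 _
  have hX1 : X ≤ 1 := hχ1 _
  have hψ : ‖r ^ (-a - 1) * (-a * w t + deriv w t / N)‖ ≤ r ^ (-a - 1) * (a * w t + C₂ / N) := by
    rw [norm_mul, Real.norm_of_nonneg hrp.le]
    refine mul_le_mul_of_nonneg_left ?_ hrp.le
    refine (norm_add_le _ _).trans ?_
    rw [norm_mul, norm_neg, Real.norm_of_nonneg ha, Real.norm_of_nonneg (hw0 t), norm_div,
      Real.norm_of_nonneg hN.le]
    gcongr
    exact hwd
  have hL : logCutoffPower w a N r = r ^ (-a) * w t := rfl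
  rw [h5, hval]
  refine (norm_add_le _ _).trans ?_
  simp only [Function.comp_apply, ← hr, norm_smul]
  rw [← hX, hL, Real.norm_of_nonneg hX0,
    Real.norm_of_nonneg (mul_nonneg (Real.rpow_nonneg hr0.le _) (hw0 t))]
  calc X * (‖r ^ (-a - 1) * (-a * w t + deriv w t / N)‖ *
        ‖fderiv ℝ (fun x => ‖Vᗮ.starProjection (x - x₀)‖) x‖) +
        r ^ (-a) * w t * ‖fderiv ℝ (fun x => χ (V.starProjection (x - x₀))) x‖
      ≤ X * (r ^ (-a - 1) * (a * w t + C₂ / N) * 1) + r ^ (-a - 1) * N⁻¹ * 1 * C₁ := by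
        rw [hpow]
        gcongr
        · have := hw0 t
          positivity
        · have := hw0 t
          positivity
        · exact hw1 t
    _ ≤ X * (r ^ (-a - 1) * (a * w t)) + 1 * (r ^ (-a - 1) * (C₂ / N)) +
        r ^ (-a - 1) * N⁻¹ * C₁ := by
        have : X * (r ^ (-a - 1) * (C₂ / N)) ≤ 1 * (r ^ (-a - 1) * (C₂ / N)) := by gcongr
        nlinarith
    _ = a * (X * (r ^ (-a) * w t) / r) + (C₁ + C₂) / N * r ^ (-a - 1) := by
        rw [hpow]
        field_simp
        ring

end TestFunction

/-! ### Scale invariance of the critical integral. -/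

section ShellMeasure

variable {E : Type*} [NormedAddCommGroup E] [InnerProductSpace ℝ E] [FiniteDimensional ℝ E]
  [MeasurableSpace E] [BorelSpace E] (μ : Measure E) [μ.IsAddHaarMeasure]

/-- The Jacobian `b ^ n` of scaling across `V` cancels the factor `b ^ (-n)` of the integrand, so
only the ratio `L` of the two radii matters. -/
theorem lintegral_cylinderShell_eq (V : Submodule ℝ E) (x₀ : E) {R b : ℝ} (hR : 0 < R) (hb : 0 < b)
    (L : ℝ) :
    ∫⁻ x in cylinderShell V x₀ R b (b * L),
        ENNReal.ofReal (‖Vᗮ.starProjection (x - x₀)‖ ^ (-(finrank ℝ Vᗮ : ℝ))) ∂μ =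
      ENNReal.ofReal (R ^ finrank ℝ V) * ∫⁻ x in cylinderShell V 0 1 1 L,
        ENNReal.ofReal (‖Vᗮ.starProjection x‖ ^ (-(finrank ℝ Vᗮ : ℝ))) ∂μ := by
  set n := finrank ℝ Vᗮ
  let f : E → ℝ≥0∞ := (cylinderShell V 0 R b (b * L)).indicator
    fun x => ENNReal.ofReal (‖Vᗮ.starProjection x‖ ^ (-(n : ℝ)))
  have hf : Measurable f :=
    Measurable.indicator (by fun_prop) (isClosed_cylinderShell _ _ _ _ _).measurableSet
  have h1 : ∫⁻ x in cylinderShell V x₀ R b (b * L),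
      ENNReal.ofReal (‖Vᗮ.starProjection (x - x₀)‖ ^ (-(n : ℝ))) ∂μ = ∫⁻ x, f (x - x₀) ∂μ := by
    rw [← lintegral_indicator (isClosed_cylinderShell _ _ _ _ _).measurableSet]
    refine lintegral_congr fun x => ?_
    simp only [f, indicator_apply, cylinderShell, mem_ofPred_eq, sub_zero]
  have h2 : ∀ x, f (orthogonalScaling V R b x) = ENNReal.ofReal (b ^ (-(n : ℝ))) *
      (cylinderShell V 0 1 1 L).indicator
        (fun x => ENNReal.ofReal (‖Vᗮ.starProjection x‖ ^ (-(n : ℝ)))) x := fun x => by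
    have hmem : orthogonalScaling V R b x ∈ cylinderShell V 0 R b (b * L) ↔
        x ∈ cylinderShell V 0 1 1 L := by
      simp only [cylinderShell, mem_ofPred_eq, sub_zero, starProjection_orthogonalScaling,
        orthogonal_starProjection_orthogonalScaling, norm_smul, Real.norm_of_nonneg hR.le,
        Real.norm_of_nonneg hb.le, mem_Icc]
      rw [mul_le_iff_le_one_right hR, le_mul_iff_one_le_right hb, mul_le_mul_iff_right₀ hb]
    by_cases hx : x ∈ cylinderShell V 0 1 1 L
    · simp only [f, indicator_of_mem hx, indicator_of_mem (hmem.2 hx),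
        orthogonal_starProjection_orthogonalScaling, norm_smul, Real.norm_of_nonneg hb.le]
      rw [Real.mul_rpow hb.le (norm_nonneg _), ENNReal.ofReal_mul (by positivity)]
    · simp only [f, indicator_of_notMem hx, indicator_of_notMem (mt hmem.1 hx), mul_zero]
  rw [h1, lintegral_sub_right_eq_self f x₀, lintegral_comp_orthogonalScaling μ V hR hb hf,
    lintegral_congr h2, lintegral_const_mul' _ _ ENNReal.ofReal_ne_top,
    lintegral_indicator (isClosed_cylinderShell _ _ _ _ _).measurableSet, ← mul_assoc,
    ← ENNReal.ofReal_mul (by positivity), Real.rpow_neg hb.le, Real.rpow_natCast, mul_assoc,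
    mul_inv_cancel₀ (by positivity), mul_one]

/-- Three shells of ratio `exp N` cover the support and have equal integrals; doubling the radius
along `V` costs `2 ^ dim V`. The constant is independent of `N`. -/
theorem lintegral_cylinderShell_le (V : Submodule ℝ E) (x₀ : E) {R N : ℝ} (hR : 0 < R) :
    ∫⁻ x in cylinderShell V x₀ (R / 2) (Real.exp (-4 * N)) (Real.exp (-N)),
        ENNReal.ofReal (‖Vᗮ.starProjection (x - x₀)‖ ^ (-(finrank ℝ Vᗮ : ℝ))) ∂μ ≤
      ENNReal.ofReal (3 * 2 ^ finrank ℝ V) *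
      ∫⁻ x in cylinderShell V x₀ (R / 4) (Real.exp (-3 * N)) (Real.exp (-3 * N) * Real.exp N),
        ENNReal.ofReal (‖Vᗮ.starProjection (x - x₀)‖ ^ (-(finrank ℝ Vᗮ : ℝ))) ∂μ := by
  let Q : ℝ → Set E := fun t =>
    cylinderShell V x₀ (R / 2) (Real.exp t) (Real.exp t * Real.exp N)
  have hcover : cylinderShell V x₀ (R / 2) (Real.exp (-4 * N)) (Real.exp (-N)) ⊆
      Q (-4 * N) ∪ (Q (-3 * N) ∪ Q (-2 * N)) := by
    rintro x ⟨hx, hb, hc⟩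
    have e1 : Real.exp (-4 * N) * Real.exp N = Real.exp (-3 * N) := by
      rw [← Real.exp_add]; congr 1; ring
    have e2 : Real.exp (-3 * N) * Real.exp N = Real.exp (-2 * N) := by
      rw [← Real.exp_add]; congr 1; ring
    have e3 : Real.exp (-2 * N) * Real.exp N = Real.exp (-N) := by
      rw [← Real.exp_add]; congr 1; ring
    rcases le_total ‖Vᗮ.starProjection (x - x₀)‖ (Real.exp (-3 * N)) with h | h
    · exact Or.inl ⟨hx, hb, by rwa [e1]⟩
    · rcases le_total ‖Vᗮ.starProjection (x - x₀)‖ (Real.exp (-2 * N)) with h' | h'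
      · exact Or.inr (Or.inl ⟨hx, h, by rwa [e2]⟩)
      · exact Or.inr (Or.inr ⟨hx, h', by rwa [e3]⟩)
  have hQ : ∀ t, ∫⁻ x in Q t,
      ENNReal.ofReal (‖Vᗮ.starProjection (x - x₀)‖ ^ (-(finrank ℝ Vᗮ : ℝ))) ∂μ = _ := fun t =>
    lintegral_cylinderShell_eq μ V x₀ (half_pos hR) (Real.exp_pos t) (Real.exp N)
  refine (lintegral_mono_set hcover).trans ((lintegral_union_le _ _ _).trans
    ((add_le_add_right (lintegral_union_le _ _ _) _).trans ?_))
  rw [hQ, hQ, hQ, lintegral_cylinderShell_eq μ V x₀ (by positivity : 0 < R / 4) (Real.exp_pos _),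
    ← mul_assoc, ← ENNReal.ofReal_mul (by positivity), ← add_mul, ← add_mul,
    ← ENNReal.ofReal_add (by positivity) (by positivity),
    ← ENNReal.ofReal_add (by positivity) (by positivity)]
  refine mul_le_mul_left (ENNReal.ofReal_le_ofReal (le_of_eq ?_)) _
  rw [show R / 2 = 2 * (R / 4) by ring, mul_pow]
  ring

end ShellMeasure

/-! ### Near-optimality of the test functions. -/

section UpperBound

theorem one_add_rpow_le_two_rpow_abs {r : ℝ} (hr : 0 ≤ r) (hr1 : r ≤ 1) (e : ℝ) :
    (1 + r) ^ e ≤ 2 ^ |e| :=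
  (Real.rpow_le_rpow_of_exponent_le (by linarith) (le_abs_self e)).trans
    (Real.rpow_le_rpow (by linarith) (by linarith) (abs_nonneg e))

theorem hardyWeight_le {δ δ' r : ℝ} (hr : 0 < r) (hr1 : r ≤ 1) :
    hardyWeight δ δ' r ≤ 2 ^ |δ' - δ| * r ^ δ := by
  rw [hardyWeight, mul_comm]
  have := one_add_rpow_le_two_rpow_abs hr.le hr1 (δ' - δ)
  gcongr

theorem le_hardyWeight {δ δ' r : ℝ} (hr : 0 < r) (hr1 : r ≤ 1) :
    r ^ δ ≤ 2 ^ |δ' - δ| * hardyWeight δ δ' r := by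
  have h := one_add_rpow_le_two_rpow_abs hr.le hr1 (-(δ' - δ))
  rw [abs_neg, Real.rpow_neg (by linarith)] at h
  have h0 : 0 < (1 + r) ^ (δ' - δ) := Real.rpow_pos_of_pos (by linarith) _
  have h1 : 1 ≤ 2 ^ |δ' - δ| * (1 + r) ^ (δ' - δ) := (inv_le_iff_one_le_mul₀ h0).1 h
  have h2 : 0 < r ^ δ := Real.rpow_pos_of_pos hr _
  rw [hardyWeight]
  nlinarith

variable {E : Type*} [NormedAddCommGroup E] [InnerProductSpace ℝ E] [FiniteDimensional ℝ E]
  [MeasurableSpace E] [BorelSpace E]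

/-- Near-optimal test functions for the weighted Hardy inequality on the complement of a closed
convex set. -/
theorem exists_lintegral_hardy_le {K : Set E} (hc : IsClosed K) (hK : Convex ℝ K) (hne : K.Nonempty)
    (μ : Measure E) [μ.IsAddHaarMeasure] {δ δ' p a ε : ℝ} (hp : 1 ≤ p) (ha : 0 ≤ a) (hε : 0 < ε)
    (hn : 0 < finrank ℝ (vectorSpan ℝ K)ᗮ)
    (hap : a * p = finrank ℝ (vectorSpan ℝ K)ᗮ + δ - p) :
    ∃ φ : E → ℝ, ContDiff ℝ 1 φ ∧ HasCompactSupport φ ∧ tsupport φ ⊆ Kᶜ ∧ φ ≠ 0 ∧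
      ∫⁻ x in Kᶜ, ENNReal.ofReal (hardyWeight δ δ' (infDist x K) * ‖fderiv ℝ φ x‖ ^ p) ∂μ ≤
      ENNReal.ofReal ((a + ε) ^ p) * ∫⁻ x in Kᶜ, ENNReal.ofReal
        (hardyWeight δ δ' (infDist x K) * infDist x K ^ (-p) * |φ x| ^ p) ∂μ := by
  obtain ⟨x₀, ρ, hρ, hdist⟩ := hK.exists_infDist_eq_norm_starProjection hc hne
  have hp0 : 0 < p := by linarith
  set V := vectorSpan ℝ K
  set n := finrank ℝ Vᗮ
  -- `χ` is `1` up to radius `ρ / 4` and vanishes from `ρ / 2` on; `w` is `1` on `[-3, -2]` and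
  -- vanishes off `[-4, -1]`.
  let χ : ContDiffBump (0 : E) := ⟨ρ / 4, ρ / 2, by positivity, by linarith⟩
  let w : ContDiffBump (-5 / 2 : ℝ) := ⟨1 / 2, 3 / 2, by norm_num, by norm_num⟩
  have hχc : ContDiff ℝ 1 χ := χ.contDiff
  have hwc : ContDiff ℝ 1 w := w.contDiff
  obtain ⟨C₁, hC₁⟩ := hχc.lipschitzWith_of_hasCompactSupport χ.hasCompactSupport one_ne_zero
  obtain ⟨C₂, hC₂⟩ := hwc.lipschitzWith_of_hasCompactSupport w.hasCompactSupport one_ne_zero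
  have hχR : ∀ v : E, ρ / 2 < ‖v‖ → χ v = 0 := fun v hv =>
    χ.zero_of_le_dist (by rw [dist_zero_right]; exact hv.le)
  have hw0 : ∀ t, t ∉ Icc (-4 : ℝ) (-1) → w t = 0 := fun t ht => by
    refine w.zero_of_le_dist ?_
    rw [Real.dist_eq]
    change 3 / 2 ≤ _
    rw [mem_Icc, not_and_or, not_le, not_le] at ht
    rcases ht with h | h
    · exact le_trans (by linarith) (neg_le_abs _)
    · exact le_trans (by linarith) (le_abs_self _)
  set A : ℝ := 2 ^ |δ' - δ| with hA
  have hA0 : 0 < A := by positivity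
  set B : ℝ := C₁ + C₂ with hB
  have hB0 : 0 ≤ B := by positivity
  -- `D` collects two weight comparisons (one on the whole support, one on the middle shell) and the
  -- shell constant; `N` is then chosen to make the error at most `ε`.
  set D : ℝ := A * A * (3 * 2 ^ finrank ℝ V) with hD
  have hD0 : 0 < D := by positivity
  set N : ℝ := max 1 (B * D ^ (1 / p) / ε) with hNdef
  have hN1 : 1 ≤ N := le_max_left _ _
  have hN : 0 < N := by linarith
  have hNε : B / N * D ^ (1 / p) ≤ ε := by
    have := (div_le_iff₀ hε).1 (le_max_right 1 (B * D ^ (1 / p) / ε))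
    rw [← hNdef] at this
    rw [div_mul_eq_mul_div, div_le_iff₀ hN]
    linarith
  let φ := cylinderTest V x₀ χ w a N
  have hφc : ContDiff ℝ 1 φ := contDiff_cylinderTest hχc hχR hwc hw0 hN
  set S := cylinderShell V x₀ (ρ / 2) (Real.exp (-4 * N)) (Real.exp (-N)) with hS
  have hSm : MeasurableSet S := (isClosed_cylinderShell _ _ _ _ _).measurableSet
  have hts : tsupport φ ⊆ S := tsupport_cylinderTest_subset hχR hw0 hN
  have hexpN : Real.exp (-N) ≤ N⁻¹ := by
    rw [Real.exp_neg]
    exact inv_anti₀ hN (by linarith [Real.add_one_le_exp N])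
  have hSr : ∀ x ∈ S, infDist x K = ‖Vᗮ.starProjection (x - x₀)‖ ∧ 0 < infDist x K ∧
      infDist x K ≤ N⁻¹ ∧ infDist x K ≤ 1 := fun x hx => by
    have h := hdist x (lt_of_le_of_lt hx.1 (by linarith))
    have h1 : infDist x K ≤ N⁻¹ := by
      rw [h]
      exact hx.2.2.trans hexpN
    refine ⟨h, ?_, h1, h1.trans (inv_le_one_of_one_le₀ hN1)⟩
    rw [h]
    exact (Real.exp_pos _).trans_le hx.2.1
  have hSK : S ⊆ Kᶜ := fun x hx => (hc.notMem_iff_infDist_pos hne).2 (hSr x hx).2.1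
  have hφ0 : ∀ x, 0 ≤ φ x := fun x =>
    mul_nonneg χ.nonneg (mul_nonneg (Real.rpow_nonneg (norm_nonneg _) _) w.nonneg)
  set M := cylinderShell V x₀ (ρ / 4) (Real.exp (-3 * N)) (Real.exp (-3 * N) * Real.exp N) with hM
  have hMS : M ⊆ S := fun x hx => by
    refine ⟨hx.1.trans (by linarith), ?_, ?_⟩
    · exact le_trans (Real.exp_le_exp.2 (by linarith)) hx.2.1
    · refine hx.2.2.trans ?_
      rw [← Real.exp_add]
      exact Real.exp_le_exp.2 (by linarith)
  have hφM : ∀ x ∈ M, φ x = infDist x K ^ (-a) := fun x hx => by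
    obtain ⟨h1, h2, -⟩ := hSr x (hMS hx)
    have hχ1 : χ (V.starProjection (x - x₀)) = 1 := by
      refine χ.one_of_mem_closedBall ?_
      rw [mem_closedBall, dist_zero_right]
      exact hx.1
    have hw1 : w (Real.log ‖Vᗮ.starProjection (x - x₀)‖ / N) = 1 := by
      refine w.one_of_mem_closedBall ?_
      rw [← h1]
      have hl := hx.2.1
      have hu := hx.2.2
      rw [← h1, ← Real.le_log_iff_exp_le h2] at hl
      rw [← h1, ← Real.exp_add, ← Real.log_le_iff_le_exp h2] at hu
      have e1 := (le_div_iff₀ hN).2 hl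
      have e2 : Real.log (infDist x K) / N ≤ -2 := (div_le_iff₀ hN).2 (by linarith)
      rw [mem_closedBall, Real.dist_eq]
      change _ ≤ 1 / 2
      exact abs_le.2 ⟨by linarith, by linarith⟩
    change χ _ * (_ * w _) = _
    rw [hχ1, hw1, h1, one_mul, mul_one]
  set Pot := ∫⁻ x in Kᶜ, ENNReal.ofReal
    (hardyWeight δ δ' (infDist x K) * infDist x K ^ (-p) * |φ x| ^ p) ∂μ with hPot
  let c : E → ℝ := fun x => hardyWeight δ δ' (infDist x K)
  have hcm : Measurable c := (measurable_hardyWeight δ δ').comp measurable_infDist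
  let f₁ : E → ℝ≥0∞ := fun x => ENNReal.ofReal (c x ^ (1 / p) * (a * (φ x / infDist x K)))
  let f₂ : E → ℝ≥0∞ := fun x =>
    ENNReal.ofReal (c x ^ (1 / p) * (B / N * infDist x K ^ (-a - 1)))
  have hφm : Measurable φ := hφc.continuous.measurable
  have hdm : Measurable fun x => infDist x K := measurable_infDist
  have hf₁ : Measurable f₁ := by fun_prop
  have hf₂ : Measurable f₂ := by fun_prop
  have hc0 : ∀ x ∈ S, 0 < c x := fun x hx => hardyWeight_pos _ _ (hSr x hx).2.1
  have hcp : ∀ x ∈ S, ∀ g, 0 ≤ g → (c x ^ (1 / p) * g) ^ p = c x * g ^ p := fun x hx g hg => by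
    rw [Real.mul_rpow (Real.rpow_nonneg (hc0 x hx).le _) hg, ← Real.rpow_mul (hc0 x hx).le,
      one_div_mul_cancel hp0.ne', Real.rpow_one]
  have hEnergy : ∫⁻ x in Kᶜ, ENNReal.ofReal (c x * ‖fderiv ℝ φ x‖ ^ p) ∂μ ≤
      ∫⁻ x in S, (f₁ x + f₂ x) ^ p ∂μ := by
    rw [← lintegral_indicator hSm]
    refine (setLIntegral_le_lintegral _ _).trans (lintegral_mono fun x => ?_)
    by_cases hx : x ∈ S
    · rw [indicator_of_mem hx]
      obtain ⟨h1, h2, h3, h4⟩ := hSr x hx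
      have hgrad := norm_fderiv_cylinderTest_le (V := V) (x₀ := x₀) hχc (fun v => χ.nonneg)
        (fun v => χ.le_one) hC₁ hwc (fun v => w.nonneg) (fun v => w.le_one) hC₂ ha hN h1 h2 h3
      have hφx := hφ0 x
      have hcx := hc0 x hx
      simp only [f₁, f₂]
      rw [← ENNReal.ofReal_add (by positivity) (by positivity), ← mul_add,
        ENNReal.ofReal_rpow_of_nonneg (by positivity) hp0.le, hcp x hx _ (by positivity)]
      refine ENNReal.ofReal_le_ofReal ?_
      gcongr
    · rw [indicator_of_notMem hx, fderiv_of_notMem_tsupport ℝ fun h => hx (hts h), norm_zero,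
        Real.zero_rpow hp0.ne', mul_zero, ENNReal.ofReal_zero]
  have hI₁ : ∫⁻ x in S, f₁ x ^ p ∂μ ≤ ENNReal.ofReal (a ^ p) * Pot := by
    rw [hPot, ← lintegral_const_mul' _ _ ENNReal.ofReal_ne_top]
    refine le_trans (setLIntegral_mono' hSm fun x hx => ?_) (lintegral_mono_set hSK)
    obtain ⟨h1, h2, h3, h4⟩ := hSr x hx
    have hφx := hφ0 x
    have hcx := hc0 x hx
    simp only [f₁]
    rw [ENNReal.ofReal_rpow_of_nonneg (by positivity) hp0.le, hcp x hx _ (by positivity),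
      ← ENNReal.ofReal_mul (by positivity)]
    refine ENNReal.ofReal_le_ofReal (le_of_eq ?_)
    rw [Real.mul_rpow ha (by positivity), Real.div_rpow hφx h2.le, abs_of_nonneg hφx,
      Real.rpow_neg h2.le]
    ring
  -- The choice of `a` makes both the `p`-th power of the error and the potential on `M` comparable
  -- to `r ^ (-n)`.
  have hexp : δ + (-a - 1) * p = -n := by linarith
  have hI₂ : ∫⁻ x in S, f₂ x ^ p ∂μ ≤ ENNReal.ofReal ((B / N) ^ p * D) * Pot := by
    calc ∫⁻ x in S, f₂ x ^ p ∂μ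
        ≤ ∫⁻ x in S, ENNReal.ofReal ((B / N) ^ p * A) *
            ENNReal.ofReal (‖Vᗮ.starProjection (x - x₀)‖ ^ (-(n : ℝ))) ∂μ := by
          refine setLIntegral_mono' hSm fun x hx => ?_
          obtain ⟨h1, h2, h3, h4⟩ := hSr x hx
          have hcx := hc0 x hx
          simp only [f₂]
          rw [ENNReal.ofReal_rpow_of_nonneg (by positivity) hp0.le, hcp x hx _ (by positivity),
            ← ENNReal.ofReal_mul (by positivity), ← h1]
          refine ENNReal.ofReal_le_ofReal ?_
          rw [Real.mul_rpow (by positivity) (by positivity), ← Real.rpow_mul h2.le, ← hexp,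
            Real.rpow_add h2]
          have := hardyWeight_le (δ := δ) (δ' := δ') h2 h4
          calc c x * ((B / N) ^ p * infDist x K ^ ((-a - 1) * p))
              ≤ (A * infDist x K ^ δ) * ((B / N) ^ p * infDist x K ^ ((-a - 1) * p)) := by gcongr
            _ = _ := by ring
      _ ≤ ENNReal.ofReal ((B / N) ^ p * A) * (ENNReal.ofReal (3 * 2 ^ finrank ℝ V) *
            ∫⁻ x in M, ENNReal.ofReal (‖Vᗮ.starProjection (x - x₀)‖ ^ (-(n : ℝ))) ∂μ) := by
          rw [lintegral_const_mul' _ _ ENNReal.ofReal_ne_top]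
          gcongr
          exact lintegral_cylinderShell_le μ V x₀ hρ
      _ ≤ ENNReal.ofReal ((B / N) ^ p * A) * (ENNReal.ofReal (3 * 2 ^ finrank ℝ V) *
            (ENNReal.ofReal A * Pot)) := by
          gcongr
          rw [hPot, ← lintegral_const_mul' _ _ ENNReal.ofReal_ne_top]
          refine le_trans (setLIntegral_mono' (isClosed_cylinderShell _ _ _ _ _).measurableSet
            fun x hx => ?_) (lintegral_mono_set (hMS.trans hSK))
          obtain ⟨h1, h2, h3, h4⟩ := hSr x (hMS hx)
          rw [← ENNReal.ofReal_mul hA0.le, ← h1, hφM x hx]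
          refine ENNReal.ofReal_le_ofReal ?_
          rw [abs_of_pos (Real.rpow_pos_of_pos h2 _), ← Real.rpow_mul h2.le, mul_assoc,
            ← Real.rpow_add h2, ← hexp, Real.rpow_add h2,
            show -p + -a * p = (-a - 1) * p by ring, ← mul_assoc]
          have := le_hardyWeight (δ := δ) (δ' := δ') h2 h4
          gcongr
      _ = ENNReal.ofReal ((B / N) ^ p * D) * Pot := by
          rw [← mul_assoc, ← mul_assoc, ← ENNReal.ofReal_mul (by positivity),
            ← ENNReal.ofReal_mul (by positivity), hD]
          congr 2
          ring
  have hroot : ∀ y : ℝ, 0 ≤ y → ∀ I : ℝ≥0∞, I ≤ ENNReal.ofReal (y ^ p) * Pot →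
      I ^ (1 / p) ≤ ENNReal.ofReal y * Pot ^ (1 / p) := fun y hy I hI => by
    refine (ENNReal.rpow_le_rpow hI (by positivity)).trans_eq ?_
    rw [ENNReal.mul_rpow_of_nonneg _ _ (by positivity),
      ENNReal.ofReal_rpow_of_nonneg (by positivity) (by positivity), ← Real.rpow_mul hy,
      mul_one_div_cancel hp0.ne', Real.rpow_one]
  have hmink := ENNReal.lintegral_Lp_add_le (μ := μ.restrict S) hf₁.aemeasurable hf₂.aemeasurable hp
  have hfinal : (∫⁻ x in S, (f₁ x + f₂ x) ^ p ∂μ) ^ (1 / p) ≤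
      ENNReal.ofReal (a + ε) * Pot ^ (1 / p) := by
    refine hmink.trans ?_
    rw [ENNReal.ofReal_add ha hε.le, add_mul]
    refine add_le_add (hroot a ha _ hI₁) ((hroot (B / N * D ^ (1 / p)) (by positivity) _ ?_).trans ?_)
    · rwa [Real.mul_rpow (by positivity) (by positivity), ← Real.rpow_mul hD0.le,
        one_div_mul_cancel hp0.ne', Real.rpow_one]
    · gcongr
  refine ⟨φ, hφc, (isCompact_cylinderShell _ _ _ _ _).of_isClosed_subset (isClosed_tsupport _) hts,
    hts.trans hSK, ?_, hEnergy.trans ?_⟩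
  -- Positive codimension supplies a point of the middle shell, where `φ` is a positive power.
  · have : Nontrivial Vᗮ := finrank_pos_iff.1 hn
    obtain ⟨v, hv⟩ := exists_norm_eq Vᗮ (Real.exp_pos (-3 * N)).le
    have h1 : Vᗮ.starProjection (v : E) = v := starProjection_eq_self_iff.2 v.2
    have h2 : V.starProjection (v : E) = 0 := (starProjection_apply_eq_zero_iff _).2 v.2
    have hx : x₀ + v ∈ M := by
      refine ⟨?_, ?_, ?_⟩
      · rw [add_sub_cancel_left, h2, norm_zero]
        positivity
      · rw [add_sub_cancel_left, h1]
        exact hv.ge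
      · rw [add_sub_cancel_left, h1]
        refine (le_of_eq hv).trans ?_
        exact le_mul_of_one_le_right (Real.exp_pos _).le (Real.one_le_exp hN.le)
    intro h0
    have := hφM _ hx
    rw [h0] at this
    exact (Real.rpow_pos_of_pos (hSr _ (hMS hx)).2.1 (-a)).ne this
  · have h := ENNReal.rpow_le_rpow hfinal hp0.le
    rwa [← ENNReal.rpow_mul, one_div_mul_cancel hp0.ne', ENNReal.rpow_one,
      ENNReal.mul_rpow_of_nonneg _ _ hp0.le, ← ENNReal.rpow_mul, one_div_mul_cancel hp0.ne',
      ENNReal.rpow_one, ENNReal.ofReal_rpow_of_nonneg (by positivity) hp0.le] at h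

end UpperBound

/-! ### From extended integrals to the Hardy constant. -/

section HardyConstant

variable {d : ℕ} {K : Set (EuclideanSpace ℝ (Fin d))} {δ δ' p : ℝ}
  {φ : EuclideanSpace ℝ (Fin d) → ℝ}

theorem boundaryDist_compl (K : Set (EuclideanSpace ℝ (Fin d))) (x : EuclideanSpace ℝ (Fin d)) :
    boundaryDist Kᶜ x = infDist x K := by
  rw [boundaryDist, compl_compl]

theorem norm_gradient_eq (φ : EuclideanSpace ℝ (Fin d) → ℝ) (x : EuclideanSpace ℝ (Fin d)) :
    ‖gradient φ x‖ = ‖fderiv ℝ φ x‖ :=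
  (InnerProductSpace.toDual ℝ _).symm.norm_map _

theorem hardyWeight_nonneg (δ δ' : ℝ) {r : ℝ} (hr : 0 ≤ r) : 0 ≤ hardyWeight δ δ' r :=
  mul_nonneg (Real.rpow_nonneg hr _) (Real.rpow_nonneg (by linarith) _)

theorem continuousOn_hardyWeight_infDist (hc : IsClosed K) (hne : K.Nonempty) :
    ContinuousOn (fun x => hardyWeight δ δ' (infDist x K)) Kᶜ := by
  have hd : ContinuousOn (fun x => infDist x K) Kᶜ := (continuous_infDist_pt K).continuousOn
  refine (hd.rpow_const fun x hx => Or.inl ?_).mul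
    ((continuousOn_const.add hd).rpow_const fun x _ => Or.inl ?_)
  · exact ((hc.notMem_iff_infDist_pos hne).1 hx).ne'
  · have := infDist_nonneg (x := x) (s := K)
    exact (by linarith : 0 < 1 + infDist x K).ne'

/-- A function that is continuous on `Ω` and vanishes outside a compact subset of `Ω` is
integrable on `Ω`. -/
theorem ContinuousOn.integrableOn_of_support_subset_isCompact {X : Type*} [TopologicalSpace X]
    [T2Space X] [MeasurableSpace X] [OpensMeasurableSpace X] {μ : Measure X}
    [IsFiniteMeasureOnCompacts μ] {Ω T : Set X} {f : X → ℝ} (hf : ContinuousOn f Ω)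
    (hT : IsCompact T) (hTΩ : T ⊆ Ω) (hfT : Function.support f ⊆ T) : IntegrableOn f Ω μ :=
  ((integrableOn_iff_integrable_of_support_subset hfT).1
    ((hf.mono hTΩ).integrableOn_compact hT)).integrableOn

theorem IsTestFunction.integrableOn_energy (hφ : IsTestFunction Kᶜ φ) (hc : IsClosed K)
    (hne : K.Nonempty) (hp : 0 < p) :
    IntegrableOn (fun x => hardyWeight δ δ' (infDist x K) * ‖fderiv ℝ φ x‖ ^ p) Kᶜ := by
  refine ContinuousOn.integrableOn_of_support_subset_isCompact (T := tsupport φ) ?_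
    hφ.hasCompactSupport hφ.tsupport_subset fun x hx => ?_
  · refine (continuousOn_hardyWeight_infDist hc hne).mul (Continuous.continuousOn ?_)
    exact (hφ.contDiff.continuous_fderiv one_ne_zero).norm.rpow_const fun _ => Or.inr hp.le
  · by_contra h
    refine hx ?_
    dsimp only
    rw [fderiv_of_notMem_tsupport ℝ h, norm_zero, Real.zero_rpow hp.ne', mul_zero]

theorem IsTestFunction.integrableOn_potential (hφ : IsTestFunction Kᶜ φ) (hc : IsClosed K)
    (hne : K.Nonempty) (hp : 0 < p) :
    IntegrableOn (fun x => hardyWeight δ δ' (infDist x K) * infDist x K ^ (-p) * |φ x| ^ p) Kᶜ := by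
  refine ContinuousOn.integrableOn_of_support_subset_isCompact (T := tsupport φ) ?_
    hφ.hasCompactSupport hφ.tsupport_subset fun x hx => ?_
  · refine ((continuousOn_hardyWeight_infDist hc hne).mul
      ((continuous_infDist_pt K).continuousOn.rpow_const fun x hx => Or.inl ?_)).mul
      (Continuous.continuousOn ?_)
    · exact ((hc.notMem_iff_infDist_pos hne).1 hx).ne'
    · exact hφ.contDiff.continuous.abs.rpow_const fun _ => Or.inr hp.le
  · by_contra h
    refine hx ?_
    dsimp only
    rw [image_eq_zero_of_notMem_tsupport h, abs_zero, Real.zero_rpow hp.ne', mul_zero]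

theorem IsTestFunction.ofReal_hardyEnergy (hφ : IsTestFunction Kᶜ φ) (hc : IsClosed K)
    (hne : K.Nonempty) (hp : 0 < p) :
    ENNReal.ofReal (hardyEnergy Kᶜ δ δ' p φ) =
      ∫⁻ x in Kᶜ, ENNReal.ofReal (hardyWeight δ δ' (infDist x K) * ‖fderiv ℝ φ x‖ ^ p) := by
  simp only [hardyEnergy, boundaryDist_compl, norm_gradient_eq]
  refine ofReal_integral_eq_lintegral_ofReal (hφ.integrableOn_energy hc hne hp)
    (Filter.Eventually.of_forall fun x => ?_)
  exact mul_nonneg (hardyWeight_nonneg _ _ infDist_nonneg) (by positivity)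

theorem potential_integrand_nonneg (x : EuclideanSpace ℝ (Fin d)) :
    0 ≤ hardyWeight δ δ' (infDist x K) * infDist x K ^ (-p) * |φ x| ^ p :=
  mul_nonneg (mul_nonneg (hardyWeight_nonneg _ _ infDist_nonneg)
    (Real.rpow_nonneg infDist_nonneg _)) (by positivity)

theorem IsTestFunction.ofReal_hardyPotential (hφ : IsTestFunction Kᶜ φ) (hc : IsClosed K)
    (hne : K.Nonempty) (hp : 0 < p) :
    ENNReal.ofReal (hardyPotential Kᶜ δ δ' p φ) = ∫⁻ x in Kᶜ, ENNReal.ofReal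
      (hardyWeight δ δ' (infDist x K) * infDist x K ^ (-p) * |φ x| ^ p) := by
  simp only [hardyPotential, boundaryDist_compl]
  exact ofReal_integral_eq_lintegral_ofReal (hφ.integrableOn_potential hc hne hp)
    (Filter.Eventually.of_forall potential_integrand_nonneg)

theorem IsTestFunction.hardyPotential_pos (hφ : IsTestFunction Kᶜ φ) (hc : IsClosed K)
    (hne : K.Nonempty) (hp : 0 < p) (h0 : φ ≠ 0) : 0 < hardyPotential Kᶜ δ δ' p φ := by
  simp only [hardyPotential, boundaryDist_compl]
  rw [setIntegral_pos_iff_support_of_nonneg_ae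
    (Filter.Eventually.of_forall potential_integrand_nonneg)
    (hφ.integrableOn_potential hc hne hp)]
  have hopen : IsOpen (Function.support φ) := hφ.contDiff.continuous.isOpen_support
  refine (hopen.measure_pos volume (Function.support_nonempty_iff.2 h0)).trans_le
    (measure_mono fun x hx => ?_)
  have hxK : x ∈ Kᶜ := hφ.tsupport_subset (subset_tsupport φ hx)
  have hr := (hc.notMem_iff_infDist_pos hne).1 hxK
  have hφx : 0 < |φ x| := abs_pos.2 hx
  have hw := hardyWeight_pos δ δ' hr
  refine ⟨?_, hxK⟩
  rw [Function.mem_support]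
  positivity

theorem hardyEnergy_nonneg (K : Set (EuclideanSpace ℝ (Fin d))) (δ δ' p : ℝ)
    (φ : EuclideanSpace ℝ (Fin d) → ℝ) : 0 ≤ hardyEnergy Kᶜ δ δ' p φ := by
  simp only [hardyEnergy, boundaryDist_compl]
  exact integral_nonneg fun x =>
    mul_nonneg (hardyWeight_nonneg _ _ infDist_nonneg) (by positivity)

/-- `htest` excludes an empty set of quotients, whose real infimum would be `0` by convention. -/
theorem le_hardyConstant_compl (hc : IsClosed K) (hK : Convex ℝ K) (hne : K.Nonempty) (hp : 1 ≤ p)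
    (hδ : δ ≤ δ') {a : ℝ} (ha : 0 < a)
    (hap : a * p = finrank ℝ (vectorSpan ℝ K)ᗮ + δ - p)
    (htest : ∃ φ, IsTestFunction Kᶜ φ ∧ φ ≠ 0) : a ^ p ≤ hardyConstant Kᶜ δ δ' p := by
  obtain ⟨φ₀, hφ₀, hφ₀0⟩ := htest
  refine le_csInf ⟨_, φ₀, hφ₀, hφ₀0, rfl⟩ ?_
  rintro _ ⟨φ, hφ, h0, rfl⟩
  have hp0 : 0 < p := by linarith
  have h := lintegral_hardy_le hc hK hne volume hδ hp ha hap hφ.contDiff hφ.hasCompactSupport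
  rw [← hφ.ofReal_hardyEnergy hc hne hp0, ← hφ.ofReal_hardyPotential hc hne hp0,
    ← ENNReal.ofReal_mul (by positivity), ENNReal.ofReal_le_ofReal_iff
      (mul_nonneg (by positivity) (hardyEnergy_nonneg K δ δ' p φ))] at h
  rw [le_div_iff₀ (hφ.hardyPotential_pos hc hne hp0 h0)]
  rw [Real.rpow_neg ha.le, inv_mul_eq_div, le_div_iff₀ (by positivity)] at h
  linarith

theorem hardyConstant_compl_le (hc : IsClosed K) (hK : Convex ℝ K) (hne : K.Nonempty) (hp : 1 ≤ p)
    (hn : 0 < finrank ℝ (vectorSpan ℝ K)ᗮ) {a : ℝ} (ha : 0 ≤ a)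
    (hap : a * p = finrank ℝ (vectorSpan ℝ K)ᗮ + δ - p) :
    (∃ φ, IsTestFunction Kᶜ φ ∧ φ ≠ 0) ∧ hardyConstant Kᶜ δ δ' p ≤ a ^ p := by
  have hp0 : 0 < p := by linarith
  have key : ∀ ε > 0, (∃ φ, IsTestFunction Kᶜ φ ∧ φ ≠ 0) ∧
      hardyConstant Kᶜ δ δ' p ≤ (a + ε) ^ p := fun ε hε => by
    obtain ⟨φ, h1, h2, h3, h0, h⟩ :=
      exists_lintegral_hardy_le (δ' := δ') hc hK hne volume hp ha hε hn hap
    have hφ : IsTestFunction Kᶜ φ := ⟨h1, h2, h3⟩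
    have hpos := hφ.hardyPotential_pos (δ := δ) (δ' := δ') hc hne hp0 h0
    rw [← hφ.ofReal_hardyEnergy hc hne hp0, ← hφ.ofReal_hardyPotential hc hne hp0,
      ← ENNReal.ofReal_mul (by positivity), ENNReal.ofReal_le_ofReal_iff (by positivity)] at h
    have hle : hardyConstant Kᶜ δ δ' p ≤ hardyEnergy Kᶜ δ δ' p φ / hardyPotential Kᶜ δ δ' p φ := by
      refine csInf_le ⟨0, ?_⟩ ⟨φ, hφ, h0, rfl⟩
      rintro _ ⟨ψ, hψ, hψ0, rfl⟩
      exact div_nonneg (hardyEnergy_nonneg K δ δ' p ψ) (hψ.hardyPotential_pos hc hne hp0 hψ0).le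
    exact ⟨⟨φ, hφ, h0⟩, hle.trans ((div_le_iff₀ hpos).2 h)⟩
  refine ⟨(key 1 one_pos).1, ?_⟩
  have hlim : Filter.Tendsto (fun ε : ℝ => (a + ε) ^ p) (nhdsWithin 0 (Ioi 0)) (nhds (a ^ p)) := by
    have : Continuous fun ε : ℝ => (a + ε) ^ p :=
      (continuous_const.add continuous_id).rpow_const fun _ => Or.inr hp0.le
    simpa using (this.tendsto 0).mono_left nhdsWithin_le_nhds
  exact ge_of_tendsto hlim (Filter.eventually_of_mem self_mem_nhdsWithin fun ε hε => (key ε hε).2)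

/-- A convex set with nonempty interior spans the whole space, so `K` is its own frontier, and a
convex set has the Hausdorff dimension of its affine hull. -/
theorem boundaryDim_compl_eq (hc : IsClosed K) (hK : Convex ℝ K) (hne : K.Nonempty)
    (hdim : convexDim K < d) : boundaryDim Kᶜ = finrank ℝ (vectorSpan ℝ K) := by
  have hint : interior K = ∅ := by
    by_contra h
    have htop := affineSpan_eq_top_of_nonempty_interior
      ((nonempty_iff_ne_empty.2 h).mono (interior_mono (subset_convexHull ℝ K)))
    rw [convexDim, htop, AffineSubspace.direction_top, finrank_top, finrank_euclideanSpace_fin]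
      at hdim
    exact lt_irrefl _ hdim
  rw [boundaryDim, frontier_compl, hc.frontier_eq, hint, sdiff_empty,
    Real.Convex.dimH_eq_finrank_vectorSpan hK hne, ENNReal.toReal_natCast]

end HardyConstant

end HardyConvexComplement

/-! ### Assembly of the two bounds. -/

theorem theorem4p2 (d : ℕ) (K : Set (EuclideanSpace ℝ (Fin d)))
    (hK_closed : IsClosed K) (hK_convex : Convex ℝ K)
    (hdim_pos : 1 ≤ convexDim K) (hdim_lt : convexDim K ≤ d - 1)
    (δ δ' p : ℝ) (hδ : 0 ≤ δ) (hδ' : 0 ≤ δ') (hp : 1 ≤ p)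
    (hpos : 0 < (d : ℝ) - boundaryDim Kᶜ + min δ δ' - p) :
    hardyConstant Kᶜ δ δ' p ≤ (((d : ℝ) - boundaryDim Kᶜ + δ - p) / p) ^ p ∧
      (δ ≤ δ' →
        hardyConstant Kᶜ δ δ' p = (((d : ℝ) - boundaryDim Kᶜ + δ - p) / p) ^ p) := by
  have hne : K.Nonempty := by
    rw [Set.nonempty_iff_ne_empty]
    rintro rfl
    simp [convexDim] at hdim_pos
  have hdim : convexDim K < d := by omega
  have hsum : Module.finrank ℝ (vectorSpan ℝ K) + Module.finrank ℝ (vectorSpan ℝ K)ᗮ = d := by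
    rw [Submodule.finrank_add_finrank_orthogonal, finrank_euclideanSpace_fin]
  have hn : 0 < Module.finrank ℝ (vectorSpan ℝ K)ᗮ := by
    rw [convexDim, direction_affineSpan] at hdim
    omega
  have hcodim : (d : ℝ) - boundaryDim Kᶜ = Module.finrank ℝ (vectorSpan ℝ K)ᗮ := by
    rw [boundaryDim_compl_eq hK_closed hK_convex hne hdim, sub_eq_iff_eq_add']
    exact_mod_cast hsum.symm
  rw [hcodim] at hpos ⊢
  have hp0 : 0 < p := by linarith
  -- Positivity of `a` follows from the hypothesis on `min δ δ'`, since the minimum is at most `δ`.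
  have ha : 0 < ((Module.finrank ℝ (vectorSpan ℝ K)ᗮ : ℝ) + δ - p) / p :=
    div_pos (by linarith [min_le_left δ δ']) hp0
  have hap := div_mul_cancel₀ ((Module.finrank ℝ (vectorSpan ℝ K)ᗮ : ℝ) + δ - p) hp0.ne'
  obtain ⟨htest, hle⟩ :=
    hardyConstant_compl_le (δ' := δ') hK_closed hK_convex hne hp hn ha.le hap
  exact ⟨hle, fun h =>
    le_antisymm hle (le_hardyConstant_compl hK_closed hK_convex hne hp h ha hap htest)⟩
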